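/- **Setting.** Let $\lambda_0,\lambda_1,\lambda_2,\mu_A\ge 0$ with $\lambda_0+\mu_A>0$, let $\theta_1,\theta_2>0$, and let $g_0=(g_{0,i})_{i\ge1}$ be a probability distribution on $\mathbb N^*=\{1,2,\dots\}$. For a rate $\lambda\ge 0$ and $\theta>0$ let $Q_{\lambda,\theta}$ be the generator on $\mathbb N^*$ with $Q_{\lambda,\theta}(i,i+1)=\lambda$, $Q_{\lambda,\theta}(i,i-1)=(i-1)\theta$, $Q_{\lambda,\theta}(i,i)=-(\lambda+(i-1)\theta)$, and all other entries $0$ (unit-sized limit orders arrive at rate $\lambda$, each share except the last one is cancelled at rate $\theta$, and there are no partial market orders, i.e. $\mu=0$). The volume at the second limit of the order book is the Markov process with generator $Q_{\lambda_2,\theta_2}$; let $\pi_2=(\pi_{2,i})_{i\ge1}$ be its stationary distribution. The volume $X$ at the best quote evolves according to the generator $Q_{\lambda_1,\theta_1}$, except that at rate $\lambda_0$ (aggressive limit orders) it is reset to an independent value with distribution $g_0$, and at rate $\mu_A$ (aggressive market orders) it is reset to an independent value with distribution $\pi_2$. Equivalently, it is killed at rate $\lambda_0+\mu_A$ and instantaneously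 resurrected with distribution $h$, where $h_i=\frac{\lambda_0}{\mu_A+\lambda_0}g_{0,i}+\frac{\mu_A}{\mu_A+\lambda_0}\pi_{2,i}$; that is, $X$ is the Markov process with generator $Q_{\lambda_1,\theta_1}(i,j)+(\lambda_0+\mu_A)(h_j-\mathbf 1_{i=j})$. **Proposition (Model 1a).** Both Markov processes exist, and each has exactly one stationary distribution. For every $i\ge 1$, $$h_i=\frac{\lambda_0\,g_{0,i}}{\mu_A+\lambda_0}+\frac{\mu_A}{\mu_A+\lambda_0}\,e^{-\lambda_2/\theta_2}\,\frac{\lambda_2^{\,i-1}}{\theta_2^{\,i-1}\,(i-1)!},$$ and the stationary distribution $(\pi_j)_{j\ge1}$ of the volume $X$ at the best quote is given, for every $j\ge1$, by the convergent series $$\pi_j=(\lambda_0+\mu_A)\sum_{i=1}^\infty h_i\sum_{k=0}^{\min(i-1,j-1)}\binom{i-1}{k}\frac{1}{(j-1-k)!}\left(\frac{\lambda_1}{\theta_1}\right)^{j-1-k}\int_0^\infty e^{-(\lambda_0+\mu_A)t}\,e^{-k\theta_1t}\,(1-e^{-\theta_1t})^{i+j-2-2k}\,e^{-\frac{\lambda_1}{\theta_1}(1-e^{-\theta_1t})}\,dt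 ,$$ with the convention $0^0=1$. -/

import Mathlib

namespace OrderBook

/-- `ν` is a probability distribution on the countable set `S`. -/
structure IsDistribution {S : Type*} (ν : S → ℝ) : Prop where
  nonneg : ∀ i, 0 ≤ ν i
  hasSum_one : HasSum ν 1

/-- `P t i j`, for `t ≥ 0`, is the (honest) transition function of a time-homogeneous
continuous-time Markov process with countable state space `S`. Values at `t < 0` are irrelevant. -/
structure IsTransitionFunction {S : Type*} [DecidableEq S] (P : ℝ → S → S → ℝ) : Prop where
  nonneg : ∀ t, 0 ≤ t → ∀ i j, 0 ≤ P t i j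
  hasSum_one : ∀ t, 0 ≤ t → ∀ i, HasSum (fun j => P t i j) 1
  zero : ∀ i j, P 0 i j = if i = j then 1 else 0
  chapman_kolmogorov : ∀ s t, 0 ≤ s → 0 ≤ t → ∀ i j,
    HasSum (fun k => P s i k * P t k j) (P (s + t) i j)

/-- The matrix `Q` is the infinitesimal generator of `P`: it is the entrywise right derivative
of `P` at time `0`. -/
def HasGenerator {S : Type*} (P : ℝ → S → S → ℝ) (Q : S → S → ℝ) : Prop :=
  ∀ i j, HasDerivWithinAt (fun t => P t i j) (Q i j) (Set.Ici 0) 0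

/-- `ν` is left invariant by the transition function `P`. -/
def IsInvariant {S : Type*} (P : ℝ → S → S → ℝ) (ν : S → ℝ) : Prop :=
  ∀ t, 0 ≤ t → ∀ j, HasSum (fun i => ν i * P t i j) (ν j)

/-- `ν` is a stationary distribution of the Markov process with infinitesimal generator `Q`:
such a process exists, and `ν` is a probability distribution that is invariant under the
transition function of any such process. -/
structure IsStationaryDistribution {S : Type*} [DecidableEq S]
    (Q : S → S → ℝ) (ν : S → ℝ) : Prop where
  isDistribution : IsDistribution ν
  exists_process : ∃ P : ℝ → S → S → ℝ, IsTransitionFunction P ∧ HasGenerator P Q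
  isInvariant : ∀ P : ℝ → S → S → ℝ, IsTransitionFunction P → HasGenerator P Q → IsInvariant P ν

/-- Generator on `ℕ` of the queue `Y`: limit orders arrive at rate `lam` with size distribution
`g`, unit-sized partial market orders arrive at rate `mu` (they have no effect on the empty queue),
and each share in the queue is cancelled at rate `theta`. -/
noncomputable def queueGenerator (lam mu theta : ℝ) (g : ℕ+ → ℝ) (i j : ℕ) : ℝ :=
  if h : i < j then lam * g ⟨j - i, Nat.sub_pos_of_lt h⟩
  else if i = j then -(lam + if i = 0 then 0 else mu + i * theta)
  else if i = j + 1 then mu + i * theta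
  else 0

/-- Generator on `{1, 2, ...}` of `1 + Y`: the volume of a limit whose last share can be neither
cancelled nor matched by a partial market order. -/
noncomputable def limitGenerator (lam mu theta : ℝ) (g : ℕ+ → ℝ) (i j : ℕ+) : ℝ :=
  queueGenerator lam mu theta g i.natPred j.natPred

/-- The distribution `h` of the volume at the best quote just after a price move: the size of an
aggressive limit order (distribution `g₀`) with probability `lam₀ / (muA + lam₀)`, the volume at
the next non-empty limit (distribution `pi₂`) with probability `muA / (muA + lam₀)`. -/
noncomputable def resetLaw (lam₀ muA : ℝ) (g₀ pi₂ : ℕ+ → ℝ) (i : ℕ+) : ℝ :=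
  lam₀ / (muA + lam₀) * g₀ i + muA / (muA + lam₀) * pi₂ i

/-- Generator of the process with generator `Q` that is killed at rate `beta` and instantaneously
resurrected, at each killing time, in an independent state with distribution `h`. -/
noncomputable def killAndResurrect {S : Type*} [DecidableEq S]
    (Q : S → S → ℝ) (beta : ℝ) (h : S → ℝ) (i j : S) : ℝ :=
  Q i j + beta * (h j - if i = j then 1 else 0)

/-- Generator of the volume `X` at the best quote in the general model. Price moves (aggressive
limit orders at rate `lam₀`, aggressive market orders at rate `muA`) reset the volume to a
variable with distribution `resetLaw lam₀ muA g₀ pi₂`; between price moves it evolves as `1 + Y`. -/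
noncomputable def bestQuoteGenerator (lam₀ lam₁ mu muA theta₁ : ℝ) (g₀ g₁ pi₂ : ℕ+ → ℝ) :
    ℕ+ → ℕ+ → ℝ :=
  killAndResurrect (limitGenerator lam₁ mu theta₁ g₁) (lam₀ + muA) (resetLaw lam₀ muA g₀ pi₂)

/-- All orders have size one. -/
def unitSize (n : ℕ+) : ℝ := if n = 1 then 1 else 0

end OrderBook

namespace OrderBook

/-! Between resets, the volume minus one is an immigration-death process. Each initial share
survives to time t with probability q = e^{-θt}, and the later arrivals still present form an
independent Poisson variable of mean (λ/θ)(1-q). The transition function is thus the explicit kernel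
`binomialPoisson`. Its semigroup law is a composition of generating functions, and its limit as q →
0 is the Poisson law that gives π₂.

Resetting at rate β = λ₀ + μ_A to the law h makes the age since the last reset exponential in
equilibrium. The stationary law is therefore ∫ β e^{-βt} (hP_t) dt, which is `resetPart` on `Ioi 0`;
expanding hP_t and the kernel gives the series. It is the only invariant law because the initial
state influences the law at time t only through mass e^{-βt}.

Stationarity is demanded for every transition function with the given generator, so that function
has to be unique although the rates are unbounded. `HasGenerator.backward` derives the backward
equation from the entrywise derivative at 0, and `IsTransitionFunction.eq_of_hasGenerator` compares
two solutions by a maximum principle with a Lyapunov function, here n + 1. -/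

open Filter Topology MeasureTheory

/-! ### Passing to the limit in series of nonnegative terms. -/

/-- Scheffé's lemma for series. -/
theorem tendsto_tsum_abs_sub_of_nonneg {α S : Type*} {l : Filter α} {a : α → S → ℝ} {b : S → ℝ}
    {A B : ℝ} (hb0 : ∀ k, 0 ≤ b k)
    (ha0 : ∀ᶠ x in l, ∀ k, 0 ≤ a x k) (ha : ∀ᶠ x in l, HasSum (a x) A) (hb : HasSum b B)
    (hAB : A = B) (hab : ∀ k, Tendsto (fun x => a x k) l (𝓝 (b k))) :
    Tendsto (fun x => ∑' k, |a x k - b k|) l (𝓝 0) := by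
  have h1 : Tendsto (fun x => ∑' k, max (b k - a x k) 0) l (𝓝 (∑' _ : S, (0 : ℝ))) := by
    refine tendsto_tsum_of_dominated_convergence hb.summable (fun k => ?_) ?_
    · have := ((tendsto_const_nhds (x := b k)).sub (hab k)).max (tendsto_const_nhds (x := (0 : ℝ)))
      simpa using this
    · filter_upwards [ha0] with x hx k
      rw [Real.norm_eq_abs, abs_of_nonneg (le_max_right _ _)]
      exact max_le (by linarith [hx k]) (hb0 k)
  have h2 : Tendsto (fun x => 2 * ∑' k, max (b k - a x k) 0) l (𝓝 0) := by
    simpa using h1.const_mul 2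
  refine h2.congr' ?_
  filter_upwards [ha0, ha] with x hx hxA
  have hs : Summable fun k => max (b k - a x k) 0 :=
    Summable.of_nonneg_of_le (fun k => le_max_right _ _)
      (fun k => max_le (by linarith [hx k]) (hb0 k)) hb.summable
  -- |a - b| = 2 (b - a)⁺ + (a - b), and the last term sums to A - B = 0.
  have h3 := (hs.hasSum.mul_left 2).add (hxA.sub hb)
  rw [hAB, sub_self, add_zero] at h3
  rw [← h3.tsum_eq]
  refine tsum_congr fun k => ?_
  rcases le_total (b k) (a x k) with h | h
  · rw [max_eq_right (by linarith), abs_of_nonneg (by linarith)]; ring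
  · rw [max_eq_left (by linarith), abs_of_nonpos (by linarith)]; ring

/-- ℓ¹ convergence survives pairing with a bounded sequence; this is what lets a derivative pass
through the infinite Chapman–Kolmogorov sum. -/
theorem tendsto_hasSum_mul_of_nonneg {α S : Type*} {l : Filter α} {a : α → S → ℝ} {b u : S → ℝ}
    {A B : ℝ} {U : α → ℝ} (hb0 : ∀ k, 0 ≤ b k)
    (ha0 : ∀ᶠ x in l, ∀ k, 0 ≤ a x k) (ha : ∀ᶠ x in l, HasSum (a x) A) (hb : HasSum b B)
    (hAB : A = B) (hab : ∀ k, Tendsto (fun x => a x k) l (𝓝 (b k))) (hu : ∀ k, |u k| ≤ 1)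
    (hU : ∀ᶠ x in l, HasSum (fun k => a x k * u k) (U x)) :
    Tendsto U l (𝓝 (∑' k, b k * u k)) := by
  have h1 := tendsto_tsum_abs_sub_of_nonneg hb0 ha0 ha hb hAB hab
  rw [tendsto_iff_norm_sub_tendsto_zero]
  refine squeeze_zero' (Eventually.of_forall fun _ => norm_nonneg _) ?_ h1
  have hbu : Summable fun k => b k * u k := by
    refine Summable.of_norm_bounded hb.summable fun k => ?_
    rw [Real.norm_eq_abs, abs_mul, abs_of_nonneg (hb0 k)]
    exact mul_le_of_le_one_right (hb0 k) (hu k)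
  filter_upwards [ha0, ha, hU] with x hx hxA hxU
  have h2 := hxU.sub hbu.hasSum
  rw [← h2.tsum_eq]
  have hs : Summable fun k => |a x k - b k| := (hxA.sub hb).summable.abs
  refine tsum_of_norm_bounded hs.hasSum fun k => ?_
  rw [← sub_mul, Real.norm_eq_abs, abs_mul]
  exact mul_le_of_le_one_right (abs_nonneg _) (hu k)

/-! ### Backward equation and uniqueness of the transition function. -/

section TransitionFunction

variable {S : Type*} [DecidableEq S] {P : ℝ → S → S → ℝ} {Q : S → S → ℝ}

theorem IsTransitionFunction.le_one (hP : IsTransitionFunction P) {t : ℝ} (ht : 0 ≤ t) (i j : S) :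
    P t i j ≤ 1 :=
  le_hasSum (hP.hasSum_one t ht i) j fun k _ => hP.nonneg t ht i k

theorem IsTransitionFunction.abs_le_one (hP : IsTransitionFunction P) {t : ℝ} (ht : 0 ≤ t)
    (i j : S) : |P t i j| ≤ 1 :=
  abs_le.2 ⟨by linarith [hP.nonneg t ht i j], hP.le_one ht i j⟩

/-- Splitting on whether the state at time s is i, the difference is -(1 - P s i i) P t i j plus a
contribution in [0, 1 - P s i i]. This turns continuity at 0 into continuity at every time. -/
theorem IsTransitionFunction.abs_sub_le (hP : IsTransitionFunction P) {s t : ℝ} (hs : 0 ≤ s)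
    (ht : 0 ≤ t) (i j : S) : |P (s + t) i j - P t i j| ≤ 1 - P s i i := by
  have h1 := hP.chapman_kolmogorov s t hs ht i j
  have h2 := hP.hasSum_one s hs i
  have hi0 := hP.nonneg s hs i i
  have hi1 := hP.le_one hs i i
  have hj0 := hP.nonneg t ht i j
  have hj1 := hP.le_one ht i j
  have h4 : P s i i * P t i j ≤ P (s + t) i j :=
    le_hasSum h1 i fun k _ => mul_nonneg (hP.nonneg s hs i k) (hP.nonneg t ht k j)
  have h5 : P (s + t) i j - P s i i * P t i j ≤ 1 - P s i i := by
    have h6 := h2.sub h1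
    have : P s i i - P s i i * P t i j ≤ 1 - P (s + t) i j := by
      refine le_hasSum h6 i fun k _ => ?_
      have := mul_le_of_le_one_right (hP.nonneg s hs i k) (hP.le_one ht k j)
      linarith
    linarith
  rw [abs_le]
  constructor <;> nlinarith

theorem HasGenerator.tendsto_zero (hP : IsTransitionFunction P) (hQ : HasGenerator P Q) (i : S) :
    Tendsto (fun s => P s i i) (𝓝[≥] 0) (𝓝 1) := by
  have := (hQ i i).continuousWithinAt
  rw [ContinuousWithinAt, hP.zero, if_pos rfl] at this
  exact this

theorem HasGenerator.continuousOn (hP : IsTransitionFunction P) (hQ : HasGenerator P Q) (i j : S) :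
    ContinuousOn (fun t => P t i j) (Set.Ici 0) := by
  have h1 : ∀ s t, 0 ≤ s → 0 ≤ t → |P s i j - P t i j| ≤ 1 - P |s - t| i i := by
    intro s t hs ht
    rcases le_total s t with h | h
    · have := hP.abs_sub_le (sub_nonneg.2 h) hs i j
      rw [sub_add_cancel] at this
      rwa [abs_sub_comm, abs_sub_comm s t, abs_of_nonneg (sub_nonneg.2 h)]
    · have := hP.abs_sub_le (sub_nonneg.2 h) ht i j
      rw [sub_add_cancel] at this
      rwa [abs_of_nonneg (sub_nonneg.2 h)]
  intro t ht
  rw [ContinuousWithinAt, tendsto_iff_norm_sub_tendsto_zero]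
  have h2' : Tendsto (fun s => |s - t|) (𝓝[Set.Ici 0] t) (𝓝[≥] 0) := by
    refine tendsto_nhdsWithin_iff.2 ⟨?_, Eventually.of_forall fun s => Set.mem_Ici.2 (abs_nonneg _)⟩
    have h0 : Tendsto (fun s => |s - t|) (𝓝 t) (𝓝 |t - t|) :=
      ((continuous_id.sub continuous_const).abs).tendsto t
    rw [sub_self, abs_zero] at h0
    exact h0.mono_left nhdsWithin_le_nhds
  have h3 := (tendsto_const_nhds (x := (1 : ℝ))).sub ((hQ.tendsto_zero hP i).comp h2')
  rw [sub_self] at h3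
  refine squeeze_zero' (Eventually.of_forall fun _ => norm_nonneg _) ?_ h3
  filter_upwards [self_mem_nhdsWithin] with s hs
  exact h1 s t hs ht

/-- Kolmogorov's backward equation. -/
theorem HasGenerator.backward (hP : IsTransitionFunction P) (hQ : HasGenerator P Q) {i : S}
    (hQi : HasSum (Q i) 0) {t : ℝ} (ht : 0 ≤ t) (j : S) :
    HasDerivWithinAt (fun s => P s i j) (∑' k, Q i k * P t k j) (Set.Ici t) t := by
  set d : S → ℝ := fun k => if i = k then 1 else 0 with hd
  have hd1 : HasSum d 1 := by
    simpa [hd, eq_comm] using hasSum_ite_eq i (1 : ℝ)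
  have hslope : ∀ k, Tendsto (fun s => s⁻¹ * (P s i k - d k)) (𝓝[>] 0) (𝓝 (Q i k)) := by
    intro k
    have h := (hasDerivWithinAt_iff_tendsto_slope' (by simp)).1
      (hasDerivWithinAt_Ioi_iff_Ici.2 (hQ i k))
    refine h.congr fun s => ?_
    simp [slope_def_field, hP.zero, hd, div_eq_inv_mul]
  -- Adding C times the identity makes the row of (P s - I)/s nonnegative for small s: its diagonal
  -- entry tends to Q i i, hence eventually exceeds Q i i - 1.
  set C : ℝ := 1 - Q i i with hC
  have hQ0 : ∀ k, i ≠ k → 0 ≤ Q i k := by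
    intro k hk
    refine ge_of_tendsto (hslope k) ?_
    filter_upwards [self_mem_nhdsWithin] with s hs
    simp only [hd, if_neg hk, sub_zero]
    exact mul_nonneg (inv_nonneg.2 (le_of_lt hs)) (hP.nonneg s (le_of_lt hs) i k)
  have hdj : HasSum (fun k => d k * P t k j) (P t i j) := by
    have := hasSum_ite_eq i (P t i j)
    refine this.congr_fun fun k => ?_
    by_cases h : i = k
    · subst h; simp [hd]
    · simp [hd, h, Ne.symm h]
  have key : Tendsto (fun s => s⁻¹ * (P (s + t) i j - P t i j) + C * P t i j) (𝓝[>] 0)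
      (𝓝 (∑' k, (Q i k + C * d k) * P t k j)) := by
    -- The shifted rows have mass C for every s; the limit row has the same mass because Q is
    -- conservative, so no mass is lost and Scheffé applies.
    refine tendsto_hasSum_mul_of_nonneg (a := fun s k => s⁻¹ * (P s i k - d k) + C * d k)
      (A := C) (B := 0 + C * 1) ?_ ?_ ?_ (hQi.add (hd1.mul_left C)) (by ring)
      (fun k => (hslope k).add_const _) (fun k => hP.abs_le_one ht k j) ?_
    · intro k
      by_cases h : i = k
      · subst h; simp [hd, hC]
      · simpa [hd, h] using hQ0 k h
    · filter_upwards [self_mem_nhdsWithin, (hslope i).eventually (lt_mem_nhds (sub_one_lt (Q i i)))]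
        with s hs h1 k
      by_cases h : i = k
      · subst h
        simp only [hd, if_true, hC, mul_one] at h1 ⊢
        linarith
      · simp only [hd, if_neg h, sub_zero, mul_zero, add_zero]
        exact mul_nonneg (inv_nonneg.2 (le_of_lt hs)) (hP.nonneg s (le_of_lt hs) i k)
    · filter_upwards [self_mem_nhdsWithin] with s hs
      have := (((hP.hasSum_one s (le_of_lt hs) i).sub hd1).mul_left s⁻¹).add (hd1.mul_left C)
      simpa using this
    · filter_upwards [self_mem_nhdsWithin] with s hs
      have := (((hP.chapman_kolmogorov s t (le_of_lt hs) ht i j).sub hdj).mul_left s⁻¹).add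
        (hdj.mul_left C)
      refine this.congr_fun fun k => ?_
      ring
  have hsQ : Summable fun k => Q i k * P t k j := by
    refine Summable.of_norm_bounded hQi.summable.abs fun k => ?_
    rw [Real.norm_eq_abs, abs_mul]
    exact mul_le_of_le_one_right (abs_nonneg _) (hP.abs_le_one ht k j)
  have h3 : ∑' k, (Q i k + C * d k) * P t k j = ∑' k, Q i k * P t k j + C * P t i j := by
    refine ((hsQ.hasSum.add (hdj.mul_left C)).congr_fun fun k => ?_).tsum_eq
    ring
  rw [h3] at key
  have key2 := key.sub_const (C * P t i j)
  simp only [add_sub_cancel_right] at key2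
  rw [← hasDerivWithinAt_Ioi_iff_Ici, hasDerivWithinAt_iff_tendsto_slope' (by simp)]
  have hshift : Tendsto (fun s => s - t) (𝓝[>] t) (𝓝[>] 0) := by
    refine tendsto_nhdsWithin_iff.2 ⟨?_, ?_⟩
    · have : Tendsto (fun s => s - t) (𝓝 t) (𝓝 (t - t)) :=
        (continuous_id.sub continuous_const).tendsto t
      rw [sub_self] at this
      exact this.mono_left nhdsWithin_le_nhds
    · filter_upwards [self_mem_nhdsWithin] with s hs
      exact Set.mem_Ioi.2 (sub_pos.2 (Set.mem_Ioi.1 hs))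
  refine (key2.comp hshift).congr fun s => ?_
  simp [slope_def_field, div_eq_inv_mul]

/-- Maximum principle for the backward equation with a Lyapunov function `V`. -/
theorem le_of_backward {Q : S → S → ℝ} {beta : ℝ} {h : S → ℝ} {V : S → ℝ} {c : ℝ}
    (hbeta : 0 ≤ beta) (hh : IsDistribution h) (hoff : ∀ i k, i ≠ k → 0 ≤ Q i k)
    (hQ : ∀ i, HasSum (Q i) 0) (hV1 : ∀ i, 1 ≤ V i) (hVfin : ∀ R, {i | V i ≤ R}.Finite)
    (hc : 0 ≤ c) (hQV : ∀ i, ∃ L, L ≤ c * V i ∧ HasSum (fun k => Q i k * V k) L)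
    {f : ℝ → S → ℝ} {T M ε : ℝ} (hε : 0 < ε) (hM0 : 0 ≤ M) (hf0 : ∀ i, f 0 i ≤ 0)
    (hfM : ∀ t ∈ Set.Icc 0 T, ∀ i, f t i ≤ M)
    (hfcont : ∀ i, ContinuousOn (fun t => f t i) (Set.Ici 0))
    (hfder : ∀ t, 0 ≤ t → ∀ i, ∃ D, HasSum (fun k => killAndResurrect Q beta h i k * f t k) D ∧
      HasDerivWithinAt (fun s => f s i) D (Set.Ici t) t) :
    ∀ t ∈ Set.Icc 0 T, ∀ i,
      f t i ≤ M * (1 - Real.exp (-beta * t)) + ε * Real.exp ((c + 1) * t) * V i := by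
  -- The barrier. The term g = M(1 - e^{-βt}) solves g' = β(M - g), which pays for resurrection, and
  -- the term in V is a strict supersolution because QV ≤ cV.
  set B : ℝ → S → ℝ := fun t i =>
    M * (1 - Real.exp (-beta * t)) + ε * Real.exp ((c + 1) * t) * V i with hB
  have hBder : ∀ t i, HasDerivAt (fun s => B s i)
      (M * (beta * Real.exp (-beta * t)) + ε * ((c + 1) * Real.exp ((c + 1) * t)) * V i) t := by
    intro t i
    have e1 : HasDerivAt (fun s => Real.exp (-beta * s)) (Real.exp (-beta * t) * (-beta * 1)) t :=
      ((hasDerivAt_id t).const_mul (-beta)).exp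
    have e2 : HasDerivAt (fun s => Real.exp ((c + 1) * s))
        (Real.exp ((c + 1) * t) * ((c + 1) * 1)) t :=
      ((hasDerivAt_id t).const_mul (c + 1)).exp
    have := ((e1.const_sub 1).const_mul M).add ((e2.const_mul ε).mul_const (V i))
    refine this.congr_deriv ?_
    ring
  have hBcont : ∀ i, Continuous (fun s => B s i) := fun i =>
    continuous_iff_continuousAt.2 fun t => (hBder t i).continuousAt
  -- Where V > M/ε the barrier already exceeds the bound M, so only finitely many states need an
  -- argument.
  have hbig : ∀ t ∈ Set.Icc 0 T, ∀ i, M / ε < V i → f t i ≤ B t i := by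
    intro t ht i hi
    rw [div_lt_iff₀ hε] at hi
    have h1 : 0 ≤ 1 - Real.exp (-beta * t) := by
      have : Real.exp (-beta * t) ≤ 1 := Real.exp_le_one_iff.2 (by nlinarith [ht.1])
      linarith
    have h2 : 1 ≤ Real.exp ((c + 1) * t) := Real.one_le_exp (mul_nonneg (by linarith) ht.1)
    have h3 : ε * V i ≤ ε * Real.exp ((c + 1) * t) * V i := by
      have := mul_le_mul_of_nonneg_left h2 (mul_nonneg hε.le (zero_le_one.trans (hV1 i)))
      linarith
    have h4 := mul_nonneg hM0 h1
    simp only [hB]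
    linarith [hfM t ht i]
  -- Continuous induction on t, which needs right derivatives only. The implication makes times
  -- beyond T belong to A trivially.
  let A : Set ℝ := {t | t ∈ Set.Icc 0 T → ∀ i, f t i ≤ B t i}
  suffices hA : Set.Icc 0 T ⊆ A from fun t ht => hA ht ht
  refine IsClosed.Icc_subset_of_forall_exists_gt ?_ ?_ ?_
  · have : A ∩ Set.Icc 0 T = Set.Icc 0 T ∩
        ⋂ i, Set.Icc 0 T ∩ (fun t => f t i - B t i) ⁻¹' Set.Iic 0 := by
      ext t
      simp only [A, Set.mem_inter_iff, Set.mem_ofPred_eq, Set.mem_iInter, Set.mem_preimage,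
        Set.mem_Iic, sub_nonpos]
      exact ⟨fun h => ⟨h.2, fun i => ⟨h.2, h.1 h.2 i⟩⟩, fun h => ⟨fun _ i => (h.2 i).2, h.1⟩⟩
    rw [this]
    refine isClosed_Icc.inter (isClosed_iInter fun i => ?_)
    exact (((hfcont i).mono Set.Icc_subset_Ici_self).sub
      (hBcont i).continuousOn).preimage_isClosed_of_isClosed isClosed_Icc isClosed_Iic
  · intro _ i
    simp only [hB]
    have := mul_pos hε (lt_of_lt_of_le one_pos (hV1 i))
    simp only [mul_zero, Real.exp_zero, sub_self, zero_add, mul_one]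
    linarith [hf0 i]
  · rintro t ⟨htA, ht0, htT⟩ y hy
    have htA' := htA ⟨ht0, htT.le⟩
    have hev : ∀ i, ∀ᶠ s in 𝓝[>] t, f s i ≤ B s i := by
      intro i
      rcases lt_or_eq_of_le (htA' i) with hlt | heq
      · have hcw : Tendsto (fun s => B s i - f s i) (𝓝[>] t) (𝓝 (B t i - f t i)) :=
          ((hBcont i).continuousAt.continuousWithinAt.sub
            (((hfcont i) t ht0).mono fun s hs => ht0.trans (le_of_lt hs)))
        filter_upwards [hcw.eventually (lt_mem_nhds (sub_pos.2 hlt))] with s hs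
        linarith
      · obtain ⟨D, hD, hDer⟩ := hfder t ht0 i
        obtain ⟨L, hL, hLs⟩ := hQV i
        -- At a contact point f equals B in state i and is at most B elsewhere, so nonnegative
        -- off-diagonal rates give Qf ≤ QB. The factor 0 is the row sum of Q acting on the part of B
        -- constant in the state.
        have hDle : D ≤ 0 * (M * (1 - Real.exp (-beta * t))) + L * (ε * Real.exp ((c + 1) * t))
            + (beta * (1 * M - f t i)) := by
          have hdi : HasSum (fun k => if i = k then f t i else 0) (f t i) := by
            simpa [eq_comm] using hasSum_ite_eq i (f t i)
          refine hasSum_le (fun k => ?_) hD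
            ((((hQ i).mul_right _).add (hLs.mul_right _)).add
              (((hh.hasSum_one.mul_right M).sub hdi).mul_left beta))
          have hfk : h k * f t k ≤ h k * M :=
            mul_le_mul_of_nonneg_left (hfM t ⟨ht0, htT.le⟩ k) (hh.nonneg k)
          have hfk' := mul_le_mul_of_nonneg_left hfk hbeta
          by_cases hik : i = k
          · subst hik
            simp only [killAndResurrect, if_true]
            have : Q i i * f t i = Q i i * (M * (1 - Real.exp (-beta * t)))
              + Q i i * V i * (ε * Real.exp ((c + 1) * t)) := by rw [heq]; simp only [hB]; ring
            nlinarith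
          · simp only [killAndResurrect, if_neg hik, sub_zero]
            have h1 := mul_le_mul_of_nonneg_left (htA' k) (hoff i k hik)
            simp only [hB] at h1
            nlinarith
        -- The +1 in the exponent c + 1 makes the inequality strict, so f falls below B just after
        -- t.
        have hneg : D - (M * (beta * Real.exp (-beta * t)) +
            ε * ((c + 1) * Real.exp ((c + 1) * t)) * V i) < 0 := by
          have he : 0 < ε * Real.exp ((c + 1) * t) := mul_pos hε (Real.exp_pos _)
          have hV := lt_of_lt_of_le one_pos (hV1 i)
          have h1 := mul_le_mul_of_nonneg_right hL he.le
          have h2 := mul_pos he hV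
          have h3 := mul_nonneg hbeta h2.le
          rw [heq] at hDle
          simp only [hB] at hDle
          nlinarith
        have hd := (hDer.sub ((hBder t i).hasDerivWithinAt (s := Set.Ici t)))
        have hsl := (hasDerivWithinAt_iff_tendsto_slope' (by simp)).1
          (hasDerivWithinAt_Ioi_iff_Ici.2 hd)
        filter_upwards [hsl.eventually (gt_mem_nhds hneg), self_mem_nhdsWithin] with s hs hst
        rw [slope_def_field] at hs
        have hst' : 0 < s - t := sub_pos.2 hst
        rw [div_lt_iff₀ hst'] at hs
        simp only [Pi.sub_apply, heq, sub_self, sub_zero, zero_mul] at hs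
        linarith
    have hfin : ∀ᶠ s in 𝓝[>] t, ∀ i ∈ {i | V i ≤ M / ε}, f s i ≤ B s i :=
      (eventually_all_finite (hVfin (M / ε))).2 fun i _ => hev i
    have hmem : ∀ᶠ s in 𝓝[>] t, s ∈ Set.Ioc t y := Ioc_mem_nhdsGT hy
    obtain ⟨s, hs, hsy⟩ := (hfin.and hmem).exists
    refine ⟨s, fun hsT i => ?_, hsy⟩
    rcases le_or_gt (V i) (M / ε) with hi | hi
    · exact hs i hi
    · exact hbig s hsT i hi

/-- A Lyapunov function forces uniqueness of the transition function with a given generator. -/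
theorem IsTransitionFunction.eq_of_hasGenerator {Q : S → S → ℝ} {beta : ℝ} {h : S → ℝ}
    {V : S → ℝ} {c : ℝ}
    (hbeta : 0 ≤ beta) (hh : IsDistribution h) (hoff : ∀ i k, i ≠ k → 0 ≤ Q i k)
    (hQ : ∀ i, HasSum (Q i) 0) (hV1 : ∀ i, 1 ≤ V i) (hVfin : ∀ R, {i | V i ≤ R}.Finite)
    (hc : 0 ≤ c) (hQV : ∀ i, ∃ L, L ≤ c * V i ∧ HasSum (fun k => Q i k * V k) L)
    {P₁ P₂ : ℝ → S → S → ℝ} (hP₁ : IsTransitionFunction P₁) (hP₂ : IsTransitionFunction P₂)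
    (hG₁ : HasGenerator P₁ (killAndResurrect Q beta h))
    (hG₂ : HasGenerator P₂ (killAndResurrect Q beta h)) {t : ℝ} (ht : 0 ≤ t) (i j : S) :
    P₁ t i j = P₂ t i j := by
  have hsum : ∀ i, HasSum (killAndResurrect Q beta h i) 0 := by
    intro i
    have hdi : HasSum (fun k => if i = k then (1 : ℝ) else 0) 1 := by
      simpa [eq_comm] using hasSum_ite_eq i (1 : ℝ)
    have := (hQ i).add ((hh.hasSum_one.sub hdi).mul_left beta)
    rwa [sub_self, mul_zero, add_zero] at this
  have key : ∀ {P₁ P₂ : ℝ → S → S → ℝ}, IsTransitionFunction P₁ → IsTransitionFunction P₂ →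
      HasGenerator P₁ (killAndResurrect Q beta h) → HasGenerator P₂ (killAndResurrect Q beta h) →
      P₁ t i j ≤ P₂ t i j := by
    intro P₁ P₂ hP₁ hP₂ hG₁ hG₂
    set r := 1 - Real.exp (-beta * t) with hr
    have hr0 : 0 ≤ r := by
      have : Real.exp (-beta * t) ≤ 1 := Real.exp_le_one_iff.2 (by nlinarith)
      linarith
    have hr1 : r < 1 := by linarith [Real.exp_pos (-beta * t)]
    -- Bootstrap: the maximum principle improves a bound M to M(1 - e^{-βs}) ≤ rM. As r < 1,
    -- iterating forces the difference to be nonpositive.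
    have hpow : ∀ n : ℕ, ∀ s ∈ Set.Icc 0 t, ∀ i, P₁ s i j - P₂ s i j ≤ r ^ n := by
      intro n
      induction n with
      | zero =>
        intro s hs i
        have h1 := hP₁.le_one hs.1 i j
        have h2 := hP₂.nonneg s hs.1 i j
        simp only [pow_zero]
        linarith
      | succ n ih =>
        intro s hs i
        refine le_of_forall_pos_le_add fun η hη => ?_
        have hV := lt_of_lt_of_le one_pos (hV1 i)
        have hE := mul_pos (Real.exp_pos ((c + 1) * s)) hV
        -- The value of ε is chosen so that the Lyapunov term of the barrier equals η at the point
        -- (s, i).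
        have h1 := le_of_backward hbeta hh hoff hQ hV1 hVfin hc hQV (T := t)
          (f := fun s i => P₁ s i j - P₂ s i j) (div_pos hη hE) (pow_nonneg hr0 n)
          (fun i => by simp [hP₁.zero, hP₂.zero]) ih
          (fun i => (hG₁.continuousOn hP₁ i j).sub (hG₂.continuousOn hP₂ i j))
          (fun s hs i => ⟨_, ?_, (hG₁.backward hP₁ (hsum i) hs j).sub
            (hG₂.backward hP₂ (hsum i) hs j)⟩) s hs i
        · have h2 : η / (Real.exp ((c + 1) * s) * V i) * Real.exp ((c + 1) * s) * V i = η := by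
            rw [mul_assoc, div_mul_cancel₀ _ hE.ne']
          have h3 : Real.exp (-beta * t) ≤ Real.exp (-beta * s) :=
            Real.exp_le_exp.2 (by nlinarith [hs.2])
          have h4 : r ^ n * (1 - Real.exp (-beta * s)) ≤ r ^ (n + 1) := by
            rw [pow_succ]
            exact mul_le_mul_of_nonneg_left (by linarith) (pow_nonneg hr0 n)
          linarith
        · have hs1 : ∀ {P : ℝ → S → S → ℝ}, IsTransitionFunction P →
              Summable fun k => killAndResurrect Q beta h i k * P s k j := by
            intro P hP
            refine Summable.of_norm_bounded (hsum i).summable.abs fun k => ?_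
            rw [Real.norm_eq_abs, abs_mul]
            exact mul_le_of_le_one_right (abs_nonneg _) (hP.abs_le_one hs k j)
          simpa only [mul_sub] using (hs1 hP₁).hasSum.sub (hs1 hP₂).hasSum
    have hlim := tendsto_pow_atTop_nhds_zero_of_lt_one hr0 hr1
    have := ge_of_tendsto' hlim fun n => hpow n t ⟨ht, le_rfl⟩ i
    linarith
  exact le_antisymm (key hP₁ hP₂ hG₁ hG₂) (key hP₂ hP₁ hG₂ hG₁)

end TransitionFunction

/-- Fubini for a finite measure, a stochastic kernel and a bounded function. It serves both for
evolving laws and for composing generating functions. -/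
theorem hasSum_tsum_mul_interchange {S R : Type*} {a : S → ℝ} {B : S → R → ℝ} {c : R → ℝ}
    (ha0 : ∀ k, 0 ≤ a k) (ha : Summable a) (hB0 : ∀ k l, 0 ≤ B k l) (hB : ∀ k, HasSum (B k) 1)
    (hc : ∀ l, |c l| ≤ 1) :
    HasSum (fun l => (∑' k, a k * B k l) * c l) (∑' k, a k * ∑' l, B k l * c l) := by
  let F : S × R → ℝ := fun x => a x.1 * B x.1 x.2
  let G : S × R → ℝ := fun x => F x * c x.2
  have hF0 : ∀ x, 0 ≤ F x := fun x => mul_nonneg (ha0 _) (hB0 _ _)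
  have h1 : Summable F := by
    refine (summable_prod_of_nonneg (f := F) hF0).2 ⟨fun k => (hB k).summable.mul_left (a k), ?_⟩
    have h0 : ∀ k, ∑' l, F (k, l) = a k := fun k => by
      simp only [F, tsum_mul_left, (hB k).tsum_eq, mul_one]
    simpa only [h0] using ha
  have h2 : Summable G := by
    refine Summable.of_norm_bounded h1 fun x => ?_
    rw [Real.norm_eq_abs, abs_mul, abs_of_nonneg (hF0 x)]
    exact mul_le_of_le_one_right (hF0 x) (hc _)
  have h3 : HasSum (fun k => a k * ∑' l, B k l * c l) (∑' x, G x) := by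
    refine h2.hasSum.prod_fiberwise fun k => ?_
    have := (h2.prod_factor k).hasSum
    rw [← tsum_mul_left]
    simpa only [G, F, mul_assoc] using this
  have h4 : HasSum (fun l => (∑' k, a k * B k l) * c l) (∑' x, G x) := by
    have h5 : HasSum (fun x : R × S => G x.swap) (∑' x, G x) :=
      ((Equiv.prodComm R S).hasSum_iff (f := G)).2 h2.hasSum
    refine h5.prod_fiberwise fun l => ?_
    exact (h1.prod_symm.prod_factor l).hasSum.mul_right (c l)
  rwa [h3.tsum_eq]

/-! ### The process reset at rate `beta`: construction and invariant law. -/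

section Reset

variable {S : Type*} [DecidableEq S] {P : ℝ → S → S → ℝ} {Q : S → S → ℝ} {h : S → ℝ} {beta : ℝ}

/-- The law at time `max s 0` of the process with transition function `P` and initial law `h`. -/
noncomputable def lawAt (P : ℝ → S → S → ℝ) (h : S → ℝ) (s : ℝ) (j : S) : ℝ :=
  ∑' k, h k * P (max s 0) k j

/-- The part of the law of the process reset at rate `beta` to the distribution `h` that comes
from paths whose age since the last reset lies in `A`. -/
noncomputable def resetPart (P : ℝ → S → S → ℝ) (beta : ℝ) (h : S → ℝ) (A : Set ℝ) (j : S) : ℝ :=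
  ∫ s in A, beta * Real.exp (-beta * s) * lawAt P h s j

/-- Transition function of the process with transition function `P` that is reset at rate `beta`
to the distribution `h`. -/
noncomputable def resetTransition (P : ℝ → S → S → ℝ) (beta : ℝ) (h : S → ℝ) (t : ℝ) (i j : S) :
    ℝ :=
  Real.exp (-beta * t) * P t i j + resetPart P beta h (Set.Ioc 0 t) j

theorem hasSum_lawAt (hP : IsTransitionFunction P) (hh : IsDistribution h) (s : ℝ) (j : S) :
    HasSum (fun k => h k * P (max s 0) k j) (lawAt P h s j) := by
  refine Summable.hasSum (Summable.of_norm_bounded hh.hasSum_one.summable fun k => ?_)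
  rw [Real.norm_eq_abs, abs_mul, abs_of_nonneg (hh.nonneg k)]
  exact mul_le_of_le_one_right (hh.nonneg k) (hP.abs_le_one (le_max_right _ _) k j)

theorem lawAt_nonneg (hP : IsTransitionFunction P) (hh : IsDistribution h) (s : ℝ) (j : S) :
    0 ≤ lawAt P h s j :=
  tsum_nonneg fun k => mul_nonneg (hh.nonneg k) (hP.nonneg _ (le_max_right _ _) k j)

theorem hasSum_lawAt_mul (hP : IsTransitionFunction P) (hh : IsDistribution h) {s t : ℝ}
    (hs : 0 ≤ s) (ht : 0 ≤ t) (j : S) :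
    HasSum (fun k => lawAt P h s k * P t k j) (lawAt P h (s + t) j) := by
  have := hasSum_tsum_mul_interchange hh.nonneg hh.hasSum_one.summable
    (hP.nonneg _ (le_max_right s 0)) (hP.hasSum_one _ (le_max_right s 0))
    (fun k => hP.abs_le_one ht k j)
  simp only [max_eq_left hs, (hP.chapman_kolmogorov s t hs ht _ j).tsum_eq] at this
  simpa only [lawAt, max_eq_left hs, max_eq_left (add_nonneg hs ht)] using this

theorem hasSum_lawAt_one (hP : IsTransitionFunction P) (hh : IsDistribution h) (s : ℝ) :
    HasSum (lawAt P h s) 1 := by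
  have := hasSum_tsum_mul_interchange hh.nonneg hh.hasSum_one.summable
    (hP.nonneg _ (le_max_right s 0)) (hP.hasSum_one _ (le_max_right s 0))
    (c := fun _ => 1) (fun k => by simp)
  simp only [mul_one, (hP.hasSum_one _ (le_max_right s 0) _).tsum_eq, hh.hasSum_one.tsum_eq] at this
  exact this

theorem lawAt_zero (hP : IsTransitionFunction P) (j : S) : lawAt P h 0 j = h j := by
  simp only [lawAt, max_self, hP.zero]
  simp

/-- Freezing the law at negative times gives continuity on the whole line, hence measurability and a
two-sided derivative of its integral at 0. -/
theorem continuous_lawAt (hP : IsTransitionFunction P) (hQ : HasGenerator P Q)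
    (hh : IsDistribution h) (j : S) : Continuous fun s => lawAt P h s j := by
  refine continuous_tsum (u := h) (fun k => ?_) hh.hasSum_one.summable fun k s => ?_
  · exact continuous_const.mul ((hQ.continuousOn hP k j).comp_continuous
      (continuous_id.max continuous_const) fun s => Set.mem_Ici.2 (le_max_right _ _))
  · rw [Real.norm_eq_abs, abs_mul, abs_of_nonneg (hh.nonneg k)]
    exact mul_le_of_le_one_right (hh.nonneg k) (hP.abs_le_one (le_max_right _ _) k j)

theorem integrableOn_mul_exp (hbeta : 0 < beta) {A : Set ℝ} (hA : A ⊆ Set.Ioi 0) :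
    IntegrableOn (fun s => beta * Real.exp (-beta * s)) A :=
  ((exp_neg_integrableOn_Ioi 0 hbeta).mono_set hA).const_mul beta

theorem hasSum_resetPart_mul [Countable S] (hP : IsTransitionFunction P) (hQ : HasGenerator P Q)
    (hh : IsDistribution h) (hbeta : 0 < beta) {A : Set ℝ} (hA : A ⊆ Set.Ioi 0)
    (hAm : MeasurableSet A) {c : S → ℝ} (hc : ∀ k, |c k| ≤ 1) {u : ℝ → ℝ}
    (hu : ∀ s ∈ A, HasSum (fun k => lawAt P h s k * c k) (u s)) :
    HasSum (fun k => resetPart P beta h A k * c k)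
      (∫ s in A, beta * Real.exp (-beta * s) * u s) := by
  have he : ∀ s, 0 ≤ beta * Real.exp (-beta * s) := fun s => by positivity
  have hsum : ∀ s, HasSum (fun k => beta * Real.exp (-beta * s) * lawAt P h s k)
      (beta * Real.exp (-beta * s)) := fun s => by
    simpa using (hasSum_lawAt_one hP hh s).mul_left (beta * Real.exp (-beta * s))
  have key := hasSum_integral_of_dominated_convergence (μ := volume.restrict A)
    (F := fun k s => beta * Real.exp (-beta * s) * lawAt P h s k * c k)
    (f := fun s => beta * Real.exp (-beta * s) * u s)
    (fun k s => beta * Real.exp (-beta * s) * lawAt P h s k) (fun k => ?_) (fun k => ?_) ?_ ?_ ?_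
  · refine key.congr_fun fun k => ?_
    rw [resetPart, integral_mul_const]
  · have := continuous_lawAt hP hQ hh k
    exact (by fun_prop : Continuous fun s =>
      beta * Real.exp (-beta * s) * lawAt P h s k * c k).aestronglyMeasurable
  · refine Eventually.of_forall fun s => ?_
    have h0 := mul_nonneg (he s) (lawAt_nonneg hP hh s k)
    rw [Real.norm_eq_abs, abs_mul, abs_of_nonneg h0]
    exact mul_le_of_le_one_right h0 (hc k)
  · exact Eventually.of_forall fun s => (hsum s).summable
  · simp only [(hsum _).tsum_eq]
    exact integrableOn_mul_exp hbeta hA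
  · refine (ae_restrict_iff' hAm).2 (Eventually.of_forall fun s hs => ?_)
    simpa only [mul_assoc] using (hu s hs).mul_left (beta * Real.exp (-beta * s))

theorem hasSum_resetPart [Countable S] (hP : IsTransitionFunction P) (hQ : HasGenerator P Q)
    (hh : IsDistribution h) (hbeta : 0 < beta) {A : Set ℝ} (hA : A ⊆ Set.Ioi 0)
    (hAm : MeasurableSet A) :
    HasSum (resetPart P beta h A) (∫ s in A, beta * Real.exp (-beta * s)) := by
  have := hasSum_resetPart_mul hP hQ hh hbeta hA hAm (c := fun _ => 1) (u := fun _ => 1)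
    (fun _ => by simp) (fun s _ => by simpa using hasSum_lawAt_one hP hh s)
  simpa using this

theorem resetPart_nonneg (hP : IsTransitionFunction P) (hh : IsDistribution h) (hbeta : 0 < beta)
    (A : Set ℝ) (j : S) : 0 ≤ resetPart P beta h A j :=
  integral_nonneg fun s => mul_nonneg (by positivity) (lawAt_nonneg hP hh s j)

/-- A path whose age lies in A - t and which then runs for time t without a reset, an event of
probability e^{-βt}, has its age in A. -/
theorem hasSum_resetPart_mul_transition [Countable S] (hP : IsTransitionFunction P)
    (hQ : HasGenerator P Q) (hh : IsDistribution h) (hbeta : 0 < beta) {t : ℝ} (ht : 0 ≤ t)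
    {A : Set ℝ} (hA : A ⊆ Set.Ioi t) (hAm : MeasurableSet A) (j : S) :
    HasSum (fun k => resetPart P beta h ((fun x => x + t) ⁻¹' A) k *
      (Real.exp (-beta * t) * P t k j)) (resetPart P beta h A j) := by
  have hA' : (fun x => x + t) ⁻¹' A ⊆ Set.Ioi 0 := fun x hx => by
    have := hA hx
    simp only [Set.mem_Ioi] at this ⊢
    linarith
  have h1 := (hasSum_resetPart_mul hP hQ hh hbeta hA' (hAm.preimage (measurable_add_const t))
    (c := fun k => P t k j) (u := fun s => lawAt P h (s + t) j) (fun k => hP.abs_le_one ht k j)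
    (fun s hs => hasSum_lawAt_mul hP hh (le_of_lt (hA' hs)) ht j)).mul_left (Real.exp (-beta * t))
  have h2 : Real.exp (-beta * t) * ∫ s in (fun x => x + t) ⁻¹' A,
      beta * Real.exp (-beta * s) * lawAt P h (s + t) j = resetPart P beta h A j := by
    have := (measurePreserving_add_right volume t).setIntegral_preimage_emb
      (measurableEmbedding_addRight t)
      (fun s => beta * Real.exp (-beta * s) * lawAt P h s j) A
    rw [resetPart, ← this, ← integral_const_mul]
    refine integral_congr_ae (Eventually.of_forall fun s => ?_)
    have : Real.exp (-beta * (s + t)) = Real.exp (-beta * t) * Real.exp (-beta * s) := by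
      rw [← Real.exp_add]; ring_nf
    simp only [this]
    ring
  rw [h2] at h1
  exact h1.congr_fun fun k => by ring

theorem integrableOn_lawAt (hP : IsTransitionFunction P) (hQ : HasGenerator P Q)
    (hh : IsDistribution h) (hbeta : 0 < beta) {A : Set ℝ} (hA : A ⊆ Set.Ioi 0) (j : S) :
    IntegrableOn (fun s => beta * Real.exp (-beta * s) * lawAt P h s j) A := by
  refine (integrableOn_mul_exp hbeta hA).mono' ?_ (Eventually.of_forall fun s => ?_)
  · have := continuous_lawAt hP hQ hh j
    exact (by fun_prop : Continuous fun s =>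
      beta * Real.exp (-beta * s) * lawAt P h s j).aestronglyMeasurable
  · have h0 : 0 ≤ beta * Real.exp (-beta * s) := by positivity
    have h1 := lawAt_nonneg hP hh s j
    rw [Real.norm_eq_abs, abs_of_nonneg (mul_nonneg h0 h1)]
    exact mul_le_of_le_one_right h0
      (le_hasSum (hasSum_lawAt_one hP hh s) j fun k _ => lawAt_nonneg hP hh s k)

theorem resetPart_union (hP : IsTransitionFunction P) (hQ : HasGenerator P Q)
    (hh : IsDistribution h) (hbeta : 0 < beta) {A B : Set ℝ} (hA : A ⊆ Set.Ioi 0)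
    (hB : B ⊆ Set.Ioi 0) (hAB : Disjoint A B) (hBm : MeasurableSet B) (j : S) :
    resetPart P beta h (A ∪ B) j = resetPart P beta h A j + resetPart P beta h B j :=
  setIntegral_union hAB hBm (integrableOn_lawAt hP hQ hh hbeta hA j)
    (integrableOn_lawAt hP hQ hh hbeta hB j)

theorem integral_Ioi_mul_exp (hbeta : 0 < beta) (t : ℝ) :
    ∫ s in Set.Ioi t, beta * Real.exp (-beta * s) = Real.exp (-beta * t) := by
  rw [integral_const_mul, integral_exp_mul_Ioi (neg_lt_zero.2 hbeta)]
  field_simp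

theorem integral_Ioc_mul_exp (hbeta : 0 < beta) {t : ℝ} (ht : 0 ≤ t) :
    ∫ s in Set.Ioc 0 t, beta * Real.exp (-beta * s) = 1 - Real.exp (-beta * t) := by
  have h1 := setIntegral_union (Set.Ioc_disjoint_Ioi_same (a := (0 : ℝ)) (b := t))
    measurableSet_Ioi (integrableOn_mul_exp hbeta Set.Ioc_subset_Ioi_self)
    (integrableOn_mul_exp hbeta (Set.Ioi_subset_Ioi ht))
  rw [Set.Ioc_union_Ioi_eq_Ioi ht, integral_Ioi_mul_exp hbeta, integral_Ioi_mul_exp hbeta] at h1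
  simp only [mul_zero, Real.exp_zero] at h1
  linarith

theorem isTransitionFunction_resetTransition [Countable S] (hP : IsTransitionFunction P)
    (hQ : HasGenerator P Q) (hh : IsDistribution h) (hbeta : 0 < beta) :
    IsTransitionFunction (resetTransition P beta h) where
  nonneg t ht i j := add_nonneg (mul_nonneg (Real.exp_nonneg _) (hP.nonneg t ht i j))
    (resetPart_nonneg hP hh hbeta _ j)
  hasSum_one t ht i := by
    have := ((hP.hasSum_one t ht i).mul_left (Real.exp (-beta * t))).add
      (hasSum_resetPart hP hQ hh hbeta Set.Ioc_subset_Ioi_self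
        (measurableSet_Ioc (a := (0 : ℝ)) (b := t)))
    rw [integral_Ioc_mul_exp hbeta ht, mul_one, add_sub_cancel] at this
    exact this
  zero i j := by simp [resetTransition, resetPart, hP.zero]
  chapman_kolmogorov s t hs ht i j := by
    -- Four cases: no reset at all (`h1`), resets in the second interval only (`h2`), in the first
    -- only (`h3`), in both (`h4`). The ages in (0, t] and (t, s + t] recombine in `h5`.
    have h1 := (hP.chapman_kolmogorov s t hs ht i j).mul_left
      (Real.exp (-beta * s) * Real.exp (-beta * t))
    have h2 := ((hP.hasSum_one s hs i).mul_left (Real.exp (-beta * s))).mul_right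
      (resetPart P beta h (Set.Ioc 0 t) j)
    have h3 := hasSum_resetPart_mul_transition hP hQ hh hbeta ht
      (Set.Ioc_subset_Ioi_self : Set.Ioc t (s + t) ⊆ _) measurableSet_Ioc j
    rw [Set.preimage_add_const_Ioc, sub_self, add_sub_cancel_right] at h3
    have h4 := (hasSum_resetPart hP hQ hh hbeta Set.Ioc_subset_Ioi_self
      (measurableSet_Ioc (a := (0 : ℝ)) (b := s))).mul_right (resetPart P beta h (Set.Ioc 0 t) j)
    rw [integral_Ioc_mul_exp hbeta hs] at h4
    have h5 := resetPart_union hP hQ hh hbeta (Set.Ioc_subset_Ioi_self : Set.Ioc 0 t ⊆ _)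
      ((Set.Ioc_subset_Ioi_self : Set.Ioc t (s + t) ⊆ _).trans (Set.Ioi_subset_Ioi ht))
      (Set.Ioc_disjoint_Ioc_of_le le_rfl) measurableSet_Ioc j
    rw [Set.Ioc_union_Ioc_eq_Ioc ht (by linarith)] at h5
    have h6 : Real.exp (-beta * (s + t)) = Real.exp (-beta * s) * Real.exp (-beta * t) := by
      rw [← Real.exp_add]; ring_nf
    have h7 := ((h1.add h2).add h3).add h4
    have h8 : resetTransition P beta h (s + t) i j =
        Real.exp (-beta * s) * Real.exp (-beta * t) * P (s + t) i j +
          Real.exp (-beta * s) * 1 * resetPart P beta h (Set.Ioc 0 t) j +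
          resetPart P beta h (Set.Ioc t (s + t)) j +
          (1 - Real.exp (-beta * s)) * resetPart P beta h (Set.Ioc 0 t) j := by
      rw [resetTransition, h5, h6]; ring
    rw [h8]
    refine h7.congr_fun fun k => ?_
    simp only [resetTransition]
    ring

theorem hasGenerator_resetTransition (hP : IsTransitionFunction P)
    (hQ : HasGenerator P Q) (hh : IsDistribution h) :
    HasGenerator (resetTransition P beta h) (killAndResurrect Q beta h) := by
  intro i j
  have hcont : Continuous fun s => beta * Real.exp (-beta * s) * lawAt P h s j := by
    have := continuous_lawAt hP hQ hh j
    fun_prop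
  have h1 : HasDerivAt (fun s : ℝ => Real.exp (-beta * s)) (Real.exp (-beta * 0) * (-beta * 1)) 0 :=
    ((hasDerivAt_id (0 : ℝ)).const_mul (-beta)).exp
  have h2 := h1.hasDerivWithinAt (s := Set.Ici 0) |>.mul (hQ i j)
  have h3 : HasDerivWithinAt (fun t => ∫ s in (0 : ℝ)..t, beta * Real.exp (-beta * s) * lawAt P h s j)
      (beta * Real.exp (-beta * 0) * lawAt P h 0 j) (Set.Ici 0) 0 :=
    (intervalIntegral.integral_hasDerivAt_right (hcont.intervalIntegrable _ _)
      hcont.stronglyMeasurable.stronglyMeasurableAtFilter hcont.continuousAt).hasDerivWithinAt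
  have h4 := (h2.add h3).congr_deriv (g' := killAndResurrect Q beta h i j) (by
    simp only [mul_zero, Real.exp_zero, lawAt_zero hP, hP.zero, killAndResurrect]
    ring)
  refine h4.congr (fun t ht => ?_) ?_
  · simp only [resetTransition, resetPart, Pi.add_apply, Pi.mul_apply,
      intervalIntegral.integral_of_le (Set.mem_Ici.1 ht)]
  · simp [resetTransition, resetPart]

theorem isDistribution_resetPart [Countable S] (hP : IsTransitionFunction P)
    (hQ : HasGenerator P Q) (hh : IsDistribution h) (hbeta : 0 < beta) :
    IsDistribution (resetPart P beta h (Set.Ioi 0)) where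
  nonneg := resetPart_nonneg hP hh hbeta _
  hasSum_one := by
    have := hasSum_resetPart hP hQ hh hbeta subset_rfl (measurableSet_Ioi (a := (0 : ℝ)))
    rw [integral_Ioi_mul_exp hbeta, mul_zero, Real.exp_zero] at this
    exact this

/-- The exponential age law is preserved: ages above t come from shifting the old ages, and ages in
(0, t] are regenerated from any starting state. -/
theorem isInvariant_resetPart [Countable S] (hP : IsTransitionFunction P)
    (hQ : HasGenerator P Q) (hh : IsDistribution h) (hbeta : 0 < beta) :
    IsInvariant (resetTransition P beta h) (resetPart P beta h (Set.Ioi 0)) := by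
  intro t ht j
  have h1 := hasSum_resetPart_mul_transition hP hQ hh hbeta ht
    (subset_refl (Set.Ioi t)) measurableSet_Ioi j
  rw [Set.preimage_add_const_Ioi, sub_self] at h1
  have h2 := (isDistribution_resetPart hP hQ hh hbeta).hasSum_one.mul_right
    (resetPart P beta h (Set.Ioc 0 t) j)
  have h3 := resetPart_union hP hQ hh hbeta (Set.Ioc_subset_Ioi_self : Set.Ioc 0 t ⊆ _)
    (Set.Ioi_subset_Ioi ht) Set.Ioc_disjoint_Ioi_same measurableSet_Ioi j
  rw [Set.Ioc_union_Ioi_eq_Ioi ht] at h3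
  have h4 := h1.add h2
  have h5 : resetPart P beta h (Set.Ioi 0) j =
      resetPart P beta h (Set.Ioi t) j + 1 * resetPart P beta h (Set.Ioc 0 t) j := by
    rw [h3]; ring
  rw [h5]
  refine h4.congr_fun fun k => ?_
  simp only [resetTransition]
  ring

/-- The reset part of the transition function does not depend on the starting state, so an invariant
law differs from it by at most e^{-βt}; then t → ∞. -/
theorem IsInvariant.eq_resetPart (hP : IsTransitionFunction P)
    (hQ : HasGenerator P Q) (hh : IsDistribution h) (hbeta : 0 < beta) {ν : S → ℝ}
    (hν : IsDistribution ν) (hinv : IsInvariant (resetTransition P beta h) ν) :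
    ν = resetPart P beta h (Set.Ioi 0) := by
  funext j
  have hb : ∀ t, 0 ≤ t → |ν j - resetPart P beta h (Set.Ioc 0 t) j| ≤ Real.exp (-beta * t) := by
    intro t ht
    have h1 := (hinv t ht j).sub (hν.hasSum_one.mul_right (resetPart P beta h (Set.Ioc 0 t) j))
    have h2 := hν.hasSum_one.mul_right (Real.exp (-beta * t))
    rw [one_mul] at h1 h2
    have h3 : ∀ k, ν k * resetTransition P beta h t k j -
        ν k * resetPart P beta h (Set.Ioc 0 t) j = ν k * (Real.exp (-beta * t) * P t k j) := by
      intro k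
      simp only [resetTransition]
      ring
    simp only [h3] at h1
    have h4 : ∀ k, 0 ≤ ν k * (Real.exp (-beta * t) * P t k j) := fun k =>
      mul_nonneg (hν.nonneg k) (mul_nonneg (Real.exp_nonneg _) (hP.nonneg t ht k j))
    rw [abs_of_nonneg (h1.nonneg h4)]
    exact hasSum_le (fun k => mul_le_mul_of_nonneg_left
      (mul_le_of_le_one_right (Real.exp_nonneg _) (hP.le_one ht k j)) (hν.nonneg k)) h1 h2
  have hlim : Tendsto (fun t : ℝ => resetPart P beta h (Set.Ioc 0 t) j) atTop
      (𝓝 (resetPart P beta h (Set.Ioi 0) j)) := by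
    refine (intervalIntegral_tendsto_integral_Ioi 0
      (integrableOn_lawAt hP hQ hh hbeta subset_rfl j) tendsto_id).congr' ?_
    filter_upwards [eventually_ge_atTop 0] with t ht
    exact intervalIntegral.integral_of_le ht
  have hexp : Tendsto (fun t : ℝ => Real.exp (-beta * t)) atTop (𝓝 0) :=
    Real.tendsto_exp_atBot.comp (tendsto_id.const_mul_atTop_of_neg (neg_lt_zero.2 hbeta))
  have h0 : Tendsto (fun t : ℝ => ν j - resetPart P beta h (Set.Ioc 0 t) j) atTop (𝓝 0) := by
    refine squeeze_zero_norm' ?_ hexp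
    filter_upwards [eventually_ge_atTop 0] with t ht
    exact hb t ht
  have h1 := tendsto_nhds_unique h0 (hlim.const_sub (ν j))
  linarith

end Reset

/-! ### Generating functions and the binomial-Poisson kernel. -/

theorem eq_zero_of_hasSum_mul_pow {d : ℕ → ℝ} (hd : Summable fun n => |d n|)
    (h : ∀ z : ℝ, 0 < z → z ≤ 1 → HasSum (fun n => d n * z ^ n) 0) (n : ℕ) : d n = 0 := by
  have h0 : ∀ d : ℕ → ℝ, (Summable fun n => |d n|) →
      (∀ z : ℝ, 0 < z → z ≤ 1 → HasSum (fun n => d n * z ^ n) 0) → d 0 = 0 := by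
    intro d hd h
    have hlim : Tendsto (fun z : ℝ => ∑' n, d n * z ^ n) (𝓝[>] 0) (𝓝 (∑' n, d n * 0 ^ n)) := by
      refine tendsto_tsum_of_dominated_convergence hd (fun n => ?_) ?_
      · have : Continuous fun z : ℝ => d n * z ^ n := by fun_prop
        exact (this.tendsto 0).mono_left nhdsWithin_le_nhds
      · filter_upwards [Ioc_mem_nhdsGT (zero_lt_one (α := ℝ))] with z hz n
        rw [Real.norm_eq_abs, abs_mul, abs_of_nonneg (pow_nonneg hz.1.le n)]
        exact mul_le_of_le_one_right (abs_nonneg _) (pow_le_one₀ hz.1.le hz.2)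
    have hzero : (fun z : ℝ => ∑' n, d n * z ^ n) =ᶠ[𝓝[>] 0] fun _ => 0 := by
      filter_upwards [Ioc_mem_nhdsGT (zero_lt_one (α := ℝ))] with z hz
      exact (h z hz.1 hz.2).tsum_eq
    have h1 := tendsto_nhds_unique (hlim.congr' hzero) tendsto_const_nhds
    rw [tsum_eq_single 0 (fun n hn => by simp [hn])] at h1
    simpa using h1
  induction n generalizing d with
  | zero => exact h0 d hd h
  | succ n ih =>
    -- Letting z → 0⁺ kills the constant coefficient; dividing by z > 0 then shifts the sequence.
    refine ih (d := fun n => d (n + 1)) ((summable_nat_add_iff 1).2 hd) fun z hz hz1 => ?_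
    have h1 := (hasSum_nat_add_iff' 1).2 (h z hz hz1)
    simp only [Finset.sum_range_one, h0 d hd h, zero_mul, sub_zero] at h1
    have h2 := h1.mul_right z⁻¹
    rw [zero_mul] at h2
    refine h2.congr_fun fun k => ?_
    rw [pow_succ]
    field_simp

/-- The law of a Binomial(`i`, `q`) variable plus an independent Poisson(`rho * (1 - q)`) one. -/
noncomputable def binomialPoisson (rho q : ℝ) (i j : ℕ) : ℝ :=
  ∑ k ∈ Finset.range (i + 1), if k ≤ j then
    (i.choose k : ℝ) * q ^ k * (1 - q) ^ (i - k) *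
      (Real.exp (-(rho * (1 - q))) * (rho * (1 - q)) ^ (j - k) / ((j - k).factorial : ℝ)) else 0

/-- The generating function of an independent sum is the product of the binomial and Poisson ones;
it is an identity in all real q and z. -/
theorem hasSum_binomialPoisson_mul_pow (rho q z : ℝ) (i : ℕ) :
    HasSum (fun j => binomialPoisson rho q i j * z ^ j)
      ((1 - q + q * z) ^ i * Real.exp (-(rho * (1 - q) * (1 - z)))) := by
  have hk : ∀ k ∈ Finset.range (i + 1), HasSum (fun j => (if k ≤ j then
      (i.choose k : ℝ) * q ^ k * (1 - q) ^ (i - k) *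
      (Real.exp (-(rho * (1 - q))) * (rho * (1 - q)) ^ (j - k) / ((j - k).factorial : ℝ)) else 0)
        * z ^ j)
      ((q * z) ^ k * (1 - q) ^ (i - k) * (i.choose k : ℝ) *
        Real.exp (-(rho * (1 - q) * (1 - z)))) := by
    intro k _
    have h1 := NormedSpace.expSeries_div_hasSum_exp (rho * (1 - q) * z)
    rw [← Real.exp_eq_exp_ℝ] at h1
    have h2 := h1.mul_left ((i.choose k : ℝ) * q ^ k * (1 - q) ^ (i - k) *
      Real.exp (-(rho * (1 - q))) * z ^ k)
    refine (hasSum_nat_add_iff' k).1 ?_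
    rw [Finset.sum_eq_zero, sub_zero]
    · have h3 : (q * z) ^ k * (1 - q) ^ (i - k) * (i.choose k : ℝ) *
          Real.exp (-(rho * (1 - q) * (1 - z))) = (i.choose k : ℝ) * q ^ k * (1 - q) ^ (i - k) *
          Real.exp (-(rho * (1 - q))) * z ^ k * Real.exp (rho * (1 - q) * z) := by
        have : Real.exp (-(rho * (1 - q) * (1 - z))) =
            Real.exp (-(rho * (1 - q))) * Real.exp (rho * (1 - q) * z) := by
          rw [← Real.exp_add]; ring_nf
        rw [this, mul_pow]; ring
      rw [h3]
      refine h2.congr_fun fun m => ?_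
      rw [if_pos (Nat.le_add_left k m), Nat.add_sub_cancel, mul_pow _ z, pow_add]
      ring
    · intro m hm
      rw [if_neg (by simpa using hm), zero_mul]
  have h := hasSum_sum hk
  rw [← Finset.sum_mul, ← add_pow, add_comm (q * z)] at h
  exact h.congr_fun fun j => by rw [binomialPoisson, Finset.sum_mul]

theorem binomialPoisson_nonneg {rho q : ℝ} (hrho : 0 ≤ rho) (hq0 : 0 ≤ q) (hq1 : q ≤ 1)
    (i j : ℕ) : 0 ≤ binomialPoisson rho q i j := by
  have h1 : 0 ≤ 1 - q := sub_nonneg.2 hq1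
  refine Finset.sum_nonneg fun k _ => ?_
  split_ifs
  · positivity
  · exact le_rfl

theorem hasSum_binomialPoisson (rho q : ℝ) (i : ℕ) : HasSum (binomialPoisson rho q i) 1 := by
  simpa using hasSum_binomialPoisson_mul_pow rho q 1 i

theorem continuous_binomialPoisson (rho : ℝ) (i j : ℕ) :
    Continuous fun q => binomialPoisson rho q i j := by
  refine continuous_finsetSum _ fun k _ => ?_
  split_ifs <;> fun_prop

theorem binomialPoisson_one (rho : ℝ) (i j : ℕ) :
    binomialPoisson rho 1 i j = if i = j then 1 else 0 := by
  rw [binomialPoisson]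
  split_ifs with h
  · subst h
    rw [Finset.sum_eq_single i]
    · simp
    · intro k hk hki
      have : i - k ≠ 0 := by have := Finset.mem_range.1 hk; omega
      simp [this]
    · simp
  · refine Finset.sum_eq_zero fun k hk => ?_
    have hk' := Finset.mem_range.1 hk
    split_ifs with hkj
    · rcases Nat.eq_zero_or_pos (i - k) with h1 | h1
      · have : j - k ≠ 0 := by omega
        simp [this]
      · simp [h1.ne']
    · rfl

theorem binomialPoisson_zero (rho : ℝ) (i j : ℕ) :
    binomialPoisson rho 0 i j = Real.exp (-rho) * rho ^ j / (j.factorial : ℝ) := by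
  rw [binomialPoisson, Finset.sum_eq_single 0]
  · simp
  · intro k _ hk
    simp [hk]
  · simp

/-- Substituting 1 - r + rz for z turns 1 - q + qz into 1 - qr + qrz, and the Poisson exponents add
up to ρ(1 - qr)(1 - z). With q = e^{-θs} and r = e^{-θt} this is Chapman–Kolmogorov; with q = 0 it
is invariance of the Poisson law. -/
theorem hasSum_binomialPoisson_mul {rho q r : ℝ} (hrho : 0 ≤ rho) (hq0 : 0 ≤ q) (hq1 : q ≤ 1)
    (hr0 : 0 ≤ r) (hr1 : r ≤ 1) (i j : ℕ) :
    HasSum (fun k => binomialPoisson rho q i k * binomialPoisson rho r k j)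
      (binomialPoisson rho (q * r) i j) := by
  have hqr0 : 0 ≤ q * r := mul_nonneg hq0 hr0
  have hqr1 : q * r ≤ 1 := mul_le_one₀ hq1 hr0 hr1
  have ha0 := binomialPoisson_nonneg hrho hq0 hq1 i
  have hB0 := binomialPoisson_nonneg hrho hr0 hr1
  have hgf := fun z : ℝ => fun hz : |z| ≤ 1 => hasSum_tsum_mul_interchange ha0
    (hasSum_binomialPoisson rho q i).summable hB0 (hasSum_binomialPoisson rho r)
    (c := fun l => z ^ l) (fun l => by rw [abs_pow]; exact pow_le_one₀ (abs_nonneg _) hz)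
  set b : ℕ → ℝ := fun l => ∑' k, binomialPoisson rho q i k * binomialPoisson rho r k l with hb
  have hgf' : ∀ z : ℝ, |z| ≤ 1 → HasSum (fun l => b l * z ^ l)
      ((1 - q * r + q * r * z) ^ i * Real.exp (-(rho * (1 - q * r) * (1 - z)))) := by
    intro z hz
    have h1 := hgf z hz
    simp only [(hasSum_binomialPoisson_mul_pow rho r z _).tsum_eq] at h1
    have h2 := ((hasSum_binomialPoisson_mul_pow rho q (1 - r + r * z) i).mul_right
      (Real.exp (-(rho * (1 - r) * (1 - z)))))
    simp only [mul_assoc (binomialPoisson _ _ _ _)] at h2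
    rw [h2.tsum_eq] at h1
    convert h1 using 1
    rw [mul_assoc (_ ^ i) (Real.exp _), ← Real.exp_add]
    ring_nf
  have hsub : ∀ z : ℝ, 0 < z → z ≤ 1 →
      HasSum (fun l => (b l - binomialPoisson rho (q * r) i l) * z ^ l) 0 := by
    intro z hz hz1
    have := (hgf' z (abs_le.2 ⟨by linarith, hz1⟩)).sub
      (hasSum_binomialPoisson_mul_pow rho (q * r) z i)
    rw [sub_self] at this
    exact this.congr_fun fun l => by ring
  have hsum : Summable fun l => |b l - binomialPoisson rho (q * r) i l| := by
    have := (hsub 1 one_pos le_rfl).summable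
    simp only [one_pow, mul_one] at this
    exact this.abs
  have heq := eq_zero_of_hasSum_mul_pow hsum hsub j
  rw [← sub_eq_zero.1 heq]
  refine Summable.hasSum (Summable.of_norm_bounded (hasSum_binomialPoisson rho q i).summable
    fun k => ?_)
  rw [Real.norm_eq_abs, abs_of_nonneg (mul_nonneg (ha0 k) (hB0 k j))]
  exact mul_le_of_le_one_right (ha0 k)
    (le_hasSum (hasSum_binomialPoisson rho r k) j fun l _ => hB0 k l)

/-! ### The unit-size generator as the derivative of the kernel at q = 1. -/

/-- The truncated `i - 1` is harmless at i = 0, where the death rate vanishes. -/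
theorem queueGenerator_unitSize (lam theta : ℝ) (i j : ℕ) :
    queueGenerator lam 0 theta unitSize i j =
      lam * ((if j = i + 1 then 1 else 0) - if j = i then 1 else 0) +
        i * theta * ((if j = i - 1 then 1 else 0) - if j = i then 1 else 0) := by
  rcases lt_trichotomy i j with h | h | h
  · rw [queueGenerator, dif_pos h]
    have h1 : j ≠ i := by omega
    have h2 : j ≠ i - 1 := by omega
    have h3 : ∀ n : ℕ+, unitSize n = if (n : ℕ) = 1 then 1 else 0 := fun n => by
      simp only [unitSize, PNat.coe_eq_one_iff]
    have h4 : j - i = 1 ↔ j = i + 1 := by omega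
    refine (congrArg (lam * ·) (h3 (⟨j - i, Nat.sub_pos_of_lt h⟩ : ℕ+))).trans ?_
    change lam * (if j - i = 1 then 1 else 0) = _
    simp [h1, h2, h4]
  · subst h
    rcases Nat.eq_zero_or_pos i with h | h
    · subst h; simp [queueGenerator]
    · have h1 : i ≠ i - 1 := by omega
      simp [queueGenerator, h.ne', h1]
      ring
  · have h1 : j ≠ i + 1 := by omega
    have h2 : j ≠ i := by omega
    have h3 : ¬ i < j := by omega
    have h4 : i = j + 1 ↔ j = i - 1 := by omega
    simp only [queueGenerator, dif_neg h3, if_neg h2.symm, h4, if_neg h1, if_neg h2]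
    split_ifs <;> ring

theorem hasSum_queueGenerator_mul (lam theta : ℝ) (i : ℕ) (v : ℕ → ℝ) :
    HasSum (fun j => queueGenerator lam 0 theta unitSize i j * v j)
      (lam * (v (i + 1) - v i) + i * theta * (v (i - 1) - v i)) := by
  have h : ∀ m : ℕ, HasSum (fun j => (if j = m then (1 : ℝ) else 0) * v j) (v m) := by
    intro m
    refine (hasSum_ite_eq m (v m)).congr_fun fun j => ?_
    split_ifs with hj
    · rw [hj, one_mul]
    · rw [zero_mul]
  refine ((((h (i + 1)).sub (h i)).mul_left lam).add
    (((h (i - 1)).sub (h i)).mul_left (i * theta))).congr_fun fun j => ?_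
  rw [queueGenerator_unitSize]
  ring

/-- To first order at q = 1, only the powers 0 and 1 of 1 - q are visible. -/
theorem hasDerivAt_mul_one_sub_pow {g : ℝ → ℝ} {g' : ℝ} (hg : HasDerivAt g g' 1) (n : ℕ) :
    HasDerivAt (fun q => g q * (1 - q) ^ n)
      (if n = 0 then g' else if n = 1 then -g 1 else 0) 1 := by
  have h1 : HasDerivAt (fun q : ℝ => (1 - q) ^ n) (n * (1 - 1) ^ (n - 1) * (-1)) 1 :=
    ((hasDerivAt_id (1 : ℝ)).const_sub 1).pow n
  refine (hg.mul h1).congr_deriv ?_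
  rcases n with _ | _ | n
  · simp
  · simp
  · simp

/-- Summand k carries (1 - q)^{(i-k)+(j-k)}, so only k = i = j or {i, j} = {k, k + 1} contribute:
the derivative is tridiagonal. The minus sign appears because q decreases from 1 as time grows. -/
theorem hasDerivAt_binomialPoisson (rho : ℝ) (i j : ℕ) :
    HasDerivAt (fun q => binomialPoisson rho q i j) (-queueGenerator rho 0 1 unitSize i j) 1 := by
  have hk : ∀ k ∈ Finset.range (i + 1), HasDerivAt (fun q => if k ≤ j then
      (i.choose k : ℝ) * q ^ k * (1 - q) ^ (i - k) *
      (Real.exp (-(rho * (1 - q))) * (rho * (1 - q)) ^ (j - k) / ((j - k).factorial : ℝ)) else 0)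
      (if k ≤ j then
        (if (i - k) + (j - k) = 0 then (k + rho) else if (i - k) + (j - k) = 1 then
          -((i.choose k : ℝ) * (rho ^ (j - k) / ((j - k).factorial : ℝ))) else 0) else 0) 1 := by
    intro k _
    split_ifs with hkj h0 h1
    all_goals try exact hasDerivAt_const _ _
    all_goals
      have e1 : HasDerivAt (fun q : ℝ => q ^ k) (k * 1 ^ (k - 1)) 1 := hasDerivAt_pow k 1
      have e2 : HasDerivAt (fun q : ℝ => Real.exp (-(rho * (1 - q))))
          (Real.exp (-(rho * (1 - 1))) * -(rho * -1)) 1 :=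
        ((((hasDerivAt_id (1 : ℝ)).const_sub 1).const_mul rho).neg).exp
      have e3 := hasDerivAt_mul_one_sub_pow (((e1.mul e2).const_mul
        ((i.choose k : ℝ) * (rho ^ (j - k) / ((j - k).factorial : ℝ))))) ((i - k) + (j - k))
      refine (e3.congr_deriv ?_).congr_of_eventuallyEq (Eventually.of_forall fun q => ?_)
      swap
      · simp only [Pi.mul_apply, mul_pow, pow_add]
        ring
    · have hi : i - k = 0 := by omega
      have hj : j - k = 0 := by omega
      have hik : i = k := by have := Finset.mem_range.1 ‹_›; omega
      subst hik
      simp [hj]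
    · rw [if_neg h0, if_pos h1]
      simp
    · rw [if_neg h0, if_neg h1]
  refine (HasDerivAt.fun_sum hk).congr_deriv ?_
  rw [queueGenerator_unitSize]
  -- In each tridiagonal case exactly one k contributes, namely min(i, j).
  by_cases h1 : j = i
  · subst h1
    rw [Finset.sum_eq_single j]
    · rcases Nat.eq_zero_or_pos j with h | h
      · subst h; simp
      · have : j ≠ j - 1 := by omega
        simp [this]
    · intro k hk hkj
      have := Finset.mem_range.1 hk
      rw [if_pos (by omega), if_neg (by omega), if_neg (by omega)]
    · simp
  by_cases h2 : j = i + 1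
  · subst h2
    rw [Finset.sum_eq_single i]
    · have : i + 1 ≠ i - 1 := by omega
      simp [this]
    · intro k hk hkj
      have := Finset.mem_range.1 hk
      rw [if_pos (by omega), if_neg (by omega), if_neg (by omega)]
    · simp
  by_cases h3 : i = j + 1
  · subst h3
    rw [Finset.sum_eq_single j]
    · have : j ≠ j + 1 + 1 := by omega
      simp [this]
    · intro k hk hkj
      have := Finset.mem_range.1 hk
      split_ifs <;> first | rfl | omega
    · simp
  · rw [Finset.sum_eq_zero]
    · rw [if_neg h1, if_neg h2]
      split_ifs with h4
      · have : i = 0 := by omega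
        simp [this]
      · simp
    · intro k hk
      have := Finset.mem_range.1 hk
      split_ifs <;> first | rfl | omega

/-! ### The limit process: generator, invariant law, uniqueness. -/

/-- Transition function of the volume `1 + Y` of a limit with unit-sized orders, where `Y` is an
immigration-death process. -/
noncomputable def limitTransition (lam theta t : ℝ) (i j : ℕ+) : ℝ :=
  binomialPoisson (lam / theta) (Real.exp (-theta * t)) i.natPred j.natPred

theorem hasSum_natPred_iff {f : ℕ → ℝ} {a : ℝ} :
    HasSum (fun i : ℕ+ => f i.natPred) a ↔ HasSum f a :=
  Equiv.pnatEquivNat.hasSum_iff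

theorem exp_neg_mul_le_one {theta t : ℝ} (htheta : 0 < theta) (ht : 0 ≤ t) :
    Real.exp (-theta * t) ≤ 1 :=
  Real.exp_le_one_iff.2 (by nlinarith)

theorem isTransitionFunction_limitTransition {lam theta : ℝ} (hlam : 0 ≤ lam) (htheta : 0 < theta) :
    IsTransitionFunction (limitTransition lam theta) where
  nonneg t ht i j := binomialPoisson_nonneg (div_nonneg hlam htheta.le) (Real.exp_nonneg _)
    (exp_neg_mul_le_one htheta ht) _ _
  hasSum_one t _ i := hasSum_natPred_iff (f := binomialPoisson (lam / theta)
    (Real.exp (-theta * t)) i.natPred) |>.2 (hasSum_binomialPoisson _ _ _)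
  zero i j := by
    simp only [limitTransition, mul_zero, Real.exp_zero, binomialPoisson_one, PNat.natPred_inj]
  chapman_kolmogorov s t hs ht i j := by
    have := hasSum_binomialPoisson_mul (div_nonneg hlam htheta.le) (Real.exp_nonneg _)
      (exp_neg_mul_le_one htheta hs) (Real.exp_nonneg _) (exp_neg_mul_le_one htheta ht)
      i.natPred j.natPred
    rw [← Real.exp_add, ← mul_add] at this
    exact hasSum_natPred_iff (f := fun k => binomialPoisson (lam / theta)
      (Real.exp (-theta * s)) i.natPred k * binomialPoisson (lam / theta)
      (Real.exp (-theta * t)) k j.natPred) |>.2 this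

/-- Chain rule along q = e^{-θt}: the factor θ turns the rates (λ/θ, 1) into (λ, θ). -/
theorem hasGenerator_limitTransition (lam : ℝ) {theta : ℝ} (htheta : 0 < theta) :
    HasGenerator (limitTransition lam theta) (limitGenerator lam 0 theta unitSize) := by
  intro i j
  have h1 : HasDerivAt (fun t : ℝ => Real.exp (-theta * t))
      (Real.exp (-theta * 0) * (-theta * 1)) 0 :=
    ((hasDerivAt_id (0 : ℝ)).const_mul (-theta)).exp
  have h2 := hasDerivAt_binomialPoisson (lam / theta) i.natPred j.natPred
  rw [show (1 : ℝ) = Real.exp (-theta * 0) by simp] at h2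
  refine ((h2.comp (0 : ℝ) h1).congr_deriv ?_).hasDerivWithinAt
  rw [limitGenerator, queueGenerator_unitSize, queueGenerator_unitSize]
  simp only [mul_zero, Real.exp_zero]
  field_simp

/-- The shifted Poisson distribution, stationary for the volume of a limit. -/
noncomputable def shiftedPoisson (rho : ℝ) (i : ℕ+) : ℝ :=
  Real.exp (-rho) * rho ^ i.natPred / (i.natPred.factorial : ℝ)

theorem isDistribution_shiftedPoisson {rho : ℝ} (hrho : 0 ≤ rho) :
    IsDistribution (shiftedPoisson rho) where
  nonneg i := by rw [shiftedPoisson]; positivity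
  hasSum_one := by
    have := hasSum_binomialPoisson rho 0 0
    rw [funext (binomialPoisson_zero rho 0)] at this
    exact hasSum_natPred_iff (f := fun k => Real.exp (-rho) * rho ^ k / (k.factorial : ℝ)) |>.2 this

theorem isInvariant_shiftedPoisson {lam theta : ℝ} (hlam : 0 ≤ lam) (htheta : 0 < theta) :
    IsInvariant (limitTransition lam theta) (shiftedPoisson (lam / theta)) := by
  intro t ht j
  have := hasSum_binomialPoisson_mul (div_nonneg hlam htheta.le) le_rfl zero_le_one
    (Real.exp_nonneg _) (exp_neg_mul_le_one htheta ht) 0 j.natPred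
  rw [zero_mul] at this
  simp only [binomialPoisson_zero] at this
  exact hasSum_natPred_iff (f := fun k => Real.exp (-(lam / theta)) * (lam / theta) ^ k /
    (k.factorial : ℝ) * binomialPoisson (lam / theta) (Real.exp (-theta * t)) k j.natPred) |>.2 this

/-- As t → ∞, q → 0 and every row of the kernel tends to the Poisson law; dominated convergence
moves this through the sum against ν. -/
theorem IsInvariant.eq_shiftedPoisson {lam theta : ℝ} (hlam : 0 ≤ lam) (htheta : 0 < theta)
    {ν : ℕ+ → ℝ} (hν : IsDistribution ν) (hinv : IsInvariant (limitTransition lam theta) ν) :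
    ν = shiftedPoisson (lam / theta) := by
  funext j
  have hP := isTransitionFunction_limitTransition hlam htheta
  have hexp : Tendsto (fun t : ℝ => Real.exp (-theta * t)) atTop (𝓝 0) :=
    Real.tendsto_exp_atBot.comp (tendsto_id.const_mul_atTop_of_neg (neg_lt_zero.2 htheta))
  have hlim : Tendsto (fun t => ∑' i, ν i * limitTransition lam theta t i j) atTop
      (𝓝 (∑' i, ν i * shiftedPoisson (lam / theta) j)) := by
    refine tendsto_tsum_of_dominated_convergence hν.hasSum_one.summable (fun i => ?_) ?_
    · have := ((continuous_binomialPoisson (lam / theta) i.natPred j.natPred).tendsto 0).comp hexp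
      rw [binomialPoisson_zero] at this
      exact this.const_mul (ν i)
    · filter_upwards [eventually_ge_atTop 0] with t ht i
      rw [Real.norm_eq_abs, abs_mul, abs_of_nonneg (hν.nonneg i)]
      exact mul_le_of_le_one_right (hν.nonneg i) (hP.abs_le_one ht i j)
  rw [(hν.hasSum_one.mul_right _).tsum_eq, one_mul] at hlim
  refine tendsto_nhds_unique (tendsto_const_nhds.congr' ?_) hlim
  filter_upwards [eventually_ge_atTop 0] with t ht
  exact (hinv t ht j).tsum_eq.symm

/-- The Lyapunov function is V = n + 1: deaths only lower it, so QV ≤ λ ≤ λV and c = λ. Allowing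
`beta` = 0 covers the process without resets. -/
theorem eq_of_hasGenerator_limitGenerator {lam theta beta : ℝ} {h : ℕ+ → ℝ} (hlam : 0 ≤ lam)
    (htheta : 0 < theta) (hbeta : 0 ≤ beta) (hh : IsDistribution h)
    {P₁ P₂ : ℝ → ℕ+ → ℕ+ → ℝ} (hP₁ : IsTransitionFunction P₁) (hP₂ : IsTransitionFunction P₂)
    (hG₁ : HasGenerator P₁ (killAndResurrect (limitGenerator lam 0 theta unitSize) beta h))
    (hG₂ : HasGenerator P₂ (killAndResurrect (limitGenerator lam 0 theta unitSize) beta h))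
    {t : ℝ} (ht : 0 ≤ t) (i j : ℕ+) : P₁ t i j = P₂ t i j := by
  refine IsTransitionFunction.eq_of_hasGenerator (V := fun i => (i.natPred : ℝ) + 1) hbeta hh ?_ ?_
    ?_ ?_ hlam ?_ hP₁ hP₂ hG₁ hG₂ ht i j
  · intro i k hik
    have h1 : k.natPred ≠ i.natPred := fun h => hik (PNat.natPred_inj.1 h).symm
    rw [limitGenerator, queueGenerator_unitSize, if_neg h1, sub_zero, sub_zero]
    have := htheta.le
    refine add_nonneg (mul_nonneg hlam ?_) (mul_nonneg (by positivity) ?_) <;> split_ifs <;> simp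
  · intro i
    have := hasSum_queueGenerator_mul lam theta i.natPred fun _ => 1
    simp only [mul_one, sub_self, mul_zero, add_zero] at this
    exact hasSum_natPred_iff (f := queueGenerator lam 0 theta unitSize i.natPred) |>.2 this
  · intro i
    simp
  · intro R
    have h1 : {n : ℕ | (n : ℝ) + 1 ≤ R}.Finite :=
      (Set.finite_Iic ⌊R⌋₊).subset fun n hn => Nat.le_floor (by
        have : (n : ℝ) + 1 ≤ R := hn
        linarith)
    exact h1.preimage PNat.natPred_injective.injOn
  · intro i
    refine ⟨_, ?_, hasSum_natPred_iff (f := fun k =>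
      queueGenerator lam 0 theta unitSize i.natPred k * ((k : ℝ) + 1)) |>.2 (hasSum_queueGenerator_mul lam theta i.natPred fun n => (n : ℝ) + 1)⟩
    have h1 : ((i.natPred - 1 : ℕ) : ℝ) ≤ i.natPred := by exact_mod_cast Nat.sub_le _ _
    have h2 : (i.natPred : ℝ) * theta *
        (((i.natPred - 1 : ℕ) : ℝ) + 1 - ((i.natPred : ℝ) + 1)) ≤ 0 :=
      mul_nonpos_of_nonneg_of_nonpos (by positivity) (by linarith)
    have h3 : (0 : ℝ) ≤ i.natPred := Nat.cast_nonneg _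
    push_cast
    nlinarith


/-! ### Identification of the stationary distributions. -/

theorem killAndResurrect_zero {S : Type*} [DecidableEq S] (Q : S → S → ℝ) (h : S → ℝ) :
    killAndResurrect Q 0 h = Q := by
  funext i j
  simp [killAndResurrect]

theorem IsInvariant.congr {S : Type*} {P₁ P₂ : ℝ → S → S → ℝ} {ν : S → ℝ}
    (h : IsInvariant P₁ ν) (heq : ∀ t, 0 ≤ t → ∀ i j, P₂ t i j = P₁ t i j) : IsInvariant P₂ ν :=
  fun t ht j => (h t ht j).congr_fun fun i => by rw [heq t ht i j]

theorem isStationaryDistribution_limitGenerator_iff {lam theta : ℝ} (hlam : 0 ≤ lam)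
    (htheta : 0 < theta) {ν : ℕ+ → ℝ} :
    IsStationaryDistribution (limitGenerator lam 0 theta unitSize) ν ↔
      ν = shiftedPoisson (lam / theta) := by
  have hP := isTransitionFunction_limitTransition hlam htheta
  have hG := hasGenerator_limitTransition lam htheta
  have hd := isDistribution_shiftedPoisson (div_nonneg hlam htheta.le)
  constructor
  · intro h
    exact (h.isInvariant _ hP hG).eq_shiftedPoisson hlam htheta h.isDistribution
  · rintro rfl
    refine ⟨hd, ⟨_, hP, hG⟩, fun P hP' hG' =>
      (isInvariant_shiftedPoisson hlam htheta).congr fun t ht i j => ?_⟩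
    -- The uniqueness result is stated for reset processes; with rate 0 the reset law is a dummy.
    rw [← killAndResurrect_zero (limitGenerator lam 0 theta unitSize)
      (shiftedPoisson (lam / theta))] at hG hG'
    exact eq_of_hasGenerator_limitGenerator hlam htheta le_rfl hd hP' hP hG' hG ht i j

theorem isStationaryDistribution_killAndResurrect_iff {lam theta beta : ℝ} {h : ℕ+ → ℝ}
    (hlam : 0 ≤ lam) (htheta : 0 < theta) (hbeta : 0 < beta) (hh : IsDistribution h)
    {ν : ℕ+ → ℝ} :
    IsStationaryDistribution (killAndResurrect (limitGenerator lam 0 theta unitSize) beta h) ν ↔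
      ν = resetPart (limitTransition lam theta) beta h (Set.Ioi 0) := by
  have hP := isTransitionFunction_limitTransition hlam htheta
  have hG := hasGenerator_limitTransition lam htheta
  have hR := isTransitionFunction_resetTransition hP hG hh hbeta
  have hRG := hasGenerator_resetTransition (beta := beta) hP hG hh
  constructor
  · intro hν
    exact (hν.isInvariant _ hR hRG).eq_resetPart hP hG hh hbeta hν.isDistribution
  · rintro rfl
    exact ⟨isDistribution_resetPart hP hG hh hbeta, ⟨_, hR, hRG⟩, fun P hP' hG' =>
      (isInvariant_resetPart hP hG hh hbeta).congr fun t ht i j =>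
        eq_of_hasGenerator_limitGenerator hlam htheta hbeta.le hh hP' hR hG' hRG ht i j⟩

theorem isDistribution_resetLaw {lam₀ muA : ℝ} {g₀ pi₂ : ℕ+ → ℝ} (hlam₀ : 0 ≤ lam₀)
    (hmuA : 0 ≤ muA) (hprice : 0 < lam₀ + muA) (hg₀ : IsDistribution g₀)
    (hpi₂ : IsDistribution pi₂) : IsDistribution (resetLaw lam₀ muA g₀ pi₂) where
  nonneg i := by
    have := hg₀.nonneg i
    have := hpi₂.nonneg i
    rw [resetLaw]
    positivity
  hasSum_one := by
    have := (hg₀.hasSum_one.mul_left (lam₀ / (muA + lam₀))).add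
      (hpi₂.hasSum_one.mul_left (muA / (muA + lam₀)))
    rwa [mul_one, mul_one, ← add_div, add_comm lam₀, div_self (by linarith)] at this

/-! ### The series and integral formula. -/

/-- Dominated convergence exchanges the sum over the reset state with the integral over the age. -/
theorem hasSum_integral_transition {S : Type*} [DecidableEq S] [Countable S]
    {P : ℝ → S → S → ℝ} {Q : S → S → ℝ} {h : S → ℝ} {beta : ℝ} (hP : IsTransitionFunction P)
    (hQ : HasGenerator P Q) (hh : IsDistribution h) (hbeta : 0 < beta) (j : S) :
    HasSum (fun i => beta * (h i * ∫ t in Set.Ioi (0 : ℝ), Real.exp (-beta * t) * P t i j))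
      (resetPart P beta h (Set.Ioi 0) j) := by
  have he : ∀ s, 0 ≤ beta * Real.exp (-beta * s) := fun s => by positivity
  have hsum : ∀ s, HasSum (fun k => beta * Real.exp (-beta * s) * h k)
      (beta * Real.exp (-beta * s)) := fun s => by
    simpa using hh.hasSum_one.mul_left (beta * Real.exp (-beta * s))
  have key := hasSum_integral_of_dominated_convergence (μ := volume.restrict (Set.Ioi (0 : ℝ)))
    (F := fun k s => beta * Real.exp (-beta * s) * (h k * P (max s 0) k j))
    (f := fun s => beta * Real.exp (-beta * s) * lawAt P h s j)
    (fun k s => beta * Real.exp (-beta * s) * h k) (fun k => ?_) (fun k => ?_) ?_ ?_ ?_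
  · refine key.congr_fun fun k => ?_
    rw [← mul_assoc, ← integral_const_mul]
    refine setIntegral_congr_fun measurableSet_Ioi fun s hs => ?_
    simp only [max_eq_left (Set.mem_Ioi.1 hs).le]
    ring
  · have h1 : Continuous fun s => P (max s 0) k j := (hQ.continuousOn hP k j).comp_continuous
      (continuous_id.max continuous_const) fun s => Set.mem_Ici.2 (le_max_right _ _)
    have h2 : Continuous fun s : ℝ => beta * Real.exp (-beta * s) := by fun_prop
    exact (h2.mul (continuous_const.mul h1)).aestronglyMeasurable
  · refine Eventually.of_forall fun s => ?_
    have h0 := hP.nonneg _ (le_max_right s 0) k j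
    rw [Real.norm_eq_abs, abs_of_nonneg (mul_nonneg (he s) (mul_nonneg (hh.nonneg k) h0))]
    exact mul_le_mul_of_nonneg_left (mul_le_of_le_one_right (hh.nonneg k)
      (hP.le_one (le_max_right s 0) k j)) (he s)
  · exact Eventually.of_forall fun s => (hsum s).summable
  · simp only [(hsum _).tsum_eq]
    exact integrableOn_mul_exp hbeta subset_rfl
  · exact Eventually.of_forall fun s => (hasSum_lawAt hP hh s j).mul_left _

theorem binomialPoisson_eq_sum_range_min (rho q : ℝ) (i j : ℕ) :
    binomialPoisson rho q i j = ∑ k ∈ Finset.range (min i j + 1),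
      (i.choose k : ℝ) * (1 / ((j - k).factorial : ℝ)) * rho ^ (j - k) *
        (q ^ k * (1 - q) ^ (i + j - 2 * k) * Real.exp (-rho * (1 - q))) := by
  rw [binomialPoisson, ← Finset.sum_subset
    (Finset.range_mono (Nat.succ_le_succ (min_le_left i j)))]
  · refine Finset.sum_congr rfl fun k hk => ?_
    have hk' := Finset.mem_range.1 hk
    have h1 : i + j - 2 * k = (i - k) + (j - k) := by omega
    rw [if_pos (by omega), h1, pow_add, mul_pow, neg_mul]
    ring
  · intro k hk hk'
    rw [Finset.mem_range] at hk hk'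
    rw [if_neg (by omega)]

theorem integral_exp_mul_limitTransition {lam theta beta : ℝ} (htheta : 0 < theta)
    (hlam : 0 ≤ lam) (hbeta : 0 < beta) (i j : ℕ+) :
    ∫ t in Set.Ioi (0 : ℝ), Real.exp (-beta * t) * limitTransition lam theta t i j =
      ∑ k ∈ Finset.range (min ((i : ℕ) - 1) ((j : ℕ) - 1) + 1),
        (Nat.choose ((i : ℕ) - 1) k : ℝ) *
          (1 / (Nat.factorial ((j : ℕ) - 1 - k) : ℝ)) *
          (lam / theta) ^ ((j : ℕ) - 1 - k) *
          ∫ t in Set.Ioi (0 : ℝ),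
            Real.exp (-beta * t) * Real.exp (-(k : ℝ) * theta * t) *
              (1 - Real.exp (-theta * t)) ^ ((i : ℕ) + (j : ℕ) - 2 - 2 * k) *
              Real.exp (-(lam / theta) * (1 - Real.exp (-theta * t))) := by
  simp only [← integral_const_mul]
  rw [← integral_finsetSum]
  · refine integral_congr_ae (Eventually.of_forall fun t => ?_)
    simp only [limitTransition, binomialPoisson_eq_sum_range_min, Finset.mul_sum]
    refine Finset.sum_congr rfl fun k _ => ?_
    have h1 : (i : ℕ) + (j : ℕ) - 2 - 2 * k = i.natPred + j.natPred - 2 * k := by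
      have h2 := i.natPred_add_one
      have h3 := j.natPred_add_one
      omega
    have h2 : Real.exp (-(k : ℝ) * theta * t) = Real.exp (-theta * t) ^ k := by
      rw [← Real.exp_nat_mul]; ring_nf
    rw [h1, h2]
    simp only [PNat.natPred]
    ring
  · intro k _
    refine Integrable.const_mul ?_ _
    -- Every factor other than e^{-βt} lies in [0, 1] for t > 0.
    refine (exp_neg_integrableOn_Ioi 0 hbeta).mono' ?_ ?_
    · exact (by fun_prop : Continuous fun t : ℝ =>
        Real.exp (-beta * t) * Real.exp (-(k : ℝ) * theta * t) *
          (1 - Real.exp (-theta * t)) ^ ((i : ℕ) + (j : ℕ) - 2 - 2 * k) *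
          Real.exp (-(lam / theta) * (1 - Real.exp (-theta * t)))).aestronglyMeasurable
    · refine (ae_restrict_iff' measurableSet_Ioi).2 (Eventually.of_forall fun t ht => ?_)
      have ht' : 0 ≤ t := (Set.mem_Ioi.1 ht).le
      have h1 : 0 ≤ 1 - Real.exp (-theta * t) := sub_nonneg.2 (exp_neg_mul_le_one htheta ht')
      have h2 : 1 - Real.exp (-theta * t) ≤ 1 := sub_le_self _ (Real.exp_nonneg _)
      have h3 : Real.exp (-(k : ℝ) * theta * t) ≤ 1 := Real.exp_le_one_iff.2 (by
        rw [neg_mul, neg_mul, neg_nonpos]; positivity)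
      have h4 : Real.exp (-(lam / theta) * (1 - Real.exp (-theta * t))) ≤ 1 :=
        Real.exp_le_one_iff.2 (by rw [neg_mul, neg_nonpos]; positivity)
      rw [Real.norm_eq_abs, abs_of_nonneg (by positivity), mul_assoc, mul_assoc]
      refine mul_le_of_le_one_right (Real.exp_nonneg _) (mul_le_one₀ h3 (by positivity)
        (mul_le_one₀ (pow_le_one₀ h1 h2) (Real.exp_nonneg _) h4))

end OrderBook

theorem mainTheorem2
    (lam₀ lam₁ lam₂ muA theta₁ theta₂ : ℝ) (g₀ : ℕ+ → ℝ)
    (hlam₀ : 0 ≤ lam₀) (hlam₁ : 0 ≤ lam₁) (hlam₂ : 0 ≤ lam₂) (hmuA : 0 ≤ muA)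
    (hprice : 0 < lam₀ + muA) (htheta₁ : 0 < theta₁) (htheta₂ : 0 < theta₂)
    (hg₀ : OrderBook.IsDistribution g₀) :
    (∃! pi₂ : ℕ+ → ℝ, OrderBook.IsStationaryDistribution
      (OrderBook.limitGenerator lam₂ 0 theta₂ OrderBook.unitSize) pi₂) ∧
    ∀ pi₂ : ℕ+ → ℝ,
      OrderBook.IsStationaryDistribution
        (OrderBook.limitGenerator lam₂ 0 theta₂ OrderBook.unitSize) pi₂ →
      (∀ i : ℕ+, OrderBook.resetLaw lam₀ muA g₀ pi₂ i =
        lam₀ * g₀ i / (muA + lam₀) +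
          muA / (muA + lam₀) * Real.exp (-(lam₂ / theta₂)) *
            (lam₂ ^ ((i : ℕ) - 1) / (theta₂ ^ ((i : ℕ) - 1) * (Nat.factorial ((i : ℕ) - 1) : ℝ)))) ∧
      (∃! p : ℕ+ → ℝ, OrderBook.IsStationaryDistribution
        (OrderBook.bestQuoteGenerator lam₀ lam₁ 0 muA theta₁ g₀ OrderBook.unitSize pi₂) p) ∧
      ∀ p : ℕ+ → ℝ,
        OrderBook.IsStationaryDistribution
          (OrderBook.bestQuoteGenerator lam₀ lam₁ 0 muA theta₁ g₀ OrderBook.unitSize pi₂) p →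
        ∀ j : ℕ+,
          HasSum
            (fun i : ℕ+ => (lam₀ + muA) * (OrderBook.resetLaw lam₀ muA g₀ pi₂ i *
              ∑ k ∈ Finset.range (min ((i : ℕ) - 1) ((j : ℕ) - 1) + 1),
                (Nat.choose ((i : ℕ) - 1) k : ℝ) *
                  (1 / (Nat.factorial ((j : ℕ) - 1 - k) : ℝ)) *
                  (lam₁ / theta₁) ^ ((j : ℕ) - 1 - k) *
                  ∫ t in Set.Ioi (0 : ℝ),
                    Real.exp (-(lam₀ + muA) * t) * Real.exp (-(k : ℝ) * theta₁ * t) *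
                      (1 - Real.exp (-theta₁ * t)) ^ ((i : ℕ) + (j : ℕ) - 2 - 2 * k) *
                      Real.exp (-(lam₁ / theta₁) * (1 - Real.exp (-theta₁ * t)))))
            (p j) := by 
  have hiff := @OrderBook.isStationaryDistribution_limitGenerator_iff lam₂ theta₂ hlam₂ htheta₂
  refine ⟨⟨_, hiff.2 rfl, fun _ h => hiff.1 h⟩, fun pi₂ hpi₂ => ?_⟩
  have hpi₂_eq := hiff.1 hpi₂
  have hh := OrderBook.isDistribution_resetLaw hlam₀ hmuA hprice hg₀ hpi₂.isDistribution
  -- `bestQuoteGenerator` unfolds to this `killAndResurrect` form, so the equivalence gives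
  -- existence, uniqueness and the value of the stationary law at once.
  have hiff₁ := @OrderBook.isStationaryDistribution_killAndResurrect_iff lam₁ theta₁ (lam₀ + muA)
    _ hlam₁ htheta₁ hprice hh
  refine ⟨fun i => ?_, ⟨_, hiff₁.2 rfl, fun _ h => hiff₁.1 h⟩, fun p hp j => ?_⟩
  · rw [OrderBook.resetLaw, hpi₂_eq, OrderBook.shiftedPoisson, div_pow]
    simp only [PNat.natPred]
    rw [div_mul_eq_mul_div, mul_div_assoc (Real.exp _), div_div, mul_assoc]
  · have h := OrderBook.hasSum_integral_transition
      (OrderBook.isTransitionFunction_limitTransition hlam₁ htheta₁)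
      (OrderBook.hasGenerator_limitTransition lam₁ htheta₁) hh hprice j
    rw [← hiff₁.1 hp] at h
    simpa only [OrderBook.integral_exp_mul_limitTransition htheta₁ hlam₁ hprice] using h
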